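/- A hypergraph $H$ has a vertex set $V(H)$ and a set $E(H)$ of edges, which are subsets of $V(H)$; its Levi graph $L_H$ is the bipartite graph on $V(H)\sqcup E(H)$ in which $v\in V(H)$ and $e\in E(H)$ are adjacent if and only if $v\in e$. The complete 3-uniform hypergraph $K_n^3$ has $n$ vertices, and its edges are all the 3-element sets of vertices. For a connected finite simple graph $G$, let $\mathsf g(G)$ be the least $h\ge 0$ such that $G$ has a 2-cell embedding in the orientable surface $\mathbb S_h$ of genus $h$ (Euler characteristic $2-2h$), and let $\widetilde{\mathsf g}(G)$ be $0$ if $G$ is planar and otherwise the least $c$ such that $G$ has a 2-cell embedding in the non-orientable surface $\mathbb N_c$ with crosscap number $c$ (Euler characteristic $2-c$). Here 2-cell embeddings are given by embedding schemes $(\pi,\lambda)$: a cyclic permutation $\pi_v$ of the neighbours of each vertex $v$, and a signature $\lambda:E(G)\to\{1,-1\}$. The faces of a scheme are its facial walks, obtained by the usual face traversal; its surface has Euler characteristic $|V(G)|-|E(G)|+|\{\text{faces}\}|$ and is orientable if and only if every cycle of $G$ has an even number of edges of signature $-1$. The genus and the non-orientable genus of a hypergraph $H$ are $\mathsf g(H)=\mathsf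 g(L_H)$ and $\widetilde{\mathsf g}(H)=\widetilde{\mathsf g}(L_H)$. **Theorem.** If $n\ge 4$ is even, then $$\mathsf g(K_n^3)=\frac{(n-2)(n+3)(n-4)}{24}.$$ If $n\ge 6$ is even, then $$\widetilde{\mathsf g}(K_n^3)=\frac{(n-2)(n+3)(n-4)}{12}.$$ -/

import Mathlib

/-- An embedding scheme `(π, λ)` of a graph: at every vertex a local rotation, that is, a cyclic
permutation of the neighbours, and on every edge a signature in `{1, -1}` telling whether the local
rotations at its two ends have been chosen consistently. Embedding schemes are the combinatorial
representation of the 2-cell embeddings of a connected graph in closed surfaces. -/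
structure EmbeddingScheme {V : Type*} (G : SimpleGraph V) where
  /-- the local rotation at each vertex -/
  rot : ∀ v : V, Equiv.Perm (G.neighborSet v)
  /-- each local rotation is one single cycle through all the neighbours -/
  rot_isCycleOn : ∀ v : V, (rot v).IsCycleOn Set.univ
  /-- the signature -/
  sign : G.edgeSet → ℤˣ

namespace EmbeddingScheme

variable {V : Type*} {G : SimpleGraph V}

/-- The signature of the edge that underlies a dart (an edge with a direction). -/
def dartSign (S : EmbeddingScheme G) (d : G.Dart) : ℤˣ :=
  S.sign ⟨d.edge, d.edge_mem⟩

/-- The dart from `v` to the neighbour `w`. -/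
def dartTo (v : V) (w : G.neighborSet v) : G.Dart :=
  ⟨(v, w.1), w.2⟩

/-- A state of the face traversal: a dart, about to be traversed, and the current mode
(`1`: use the local rotations, `-1`: use their inverses). -/
abbrev Flag (G : SimpleGraph V) : Type _ := G.Dart × ℤˣ

/-- One step of the face traversal: traverse the dart `u → v`, change the mode if the edge has
signature `-1`, and leave `v` along the successor (in mode `1`) or the predecessor (in mode `-1`)
of `u` in the local rotation at `v`. -/
def next (S : EmbeddingScheme G) (x : Flag G) : Flag G :=
  let m : ℤˣ := x.2 * S.dartSign x.1
  (dartTo x.1.snd ((S.rot x.1.snd ^ (m : ℤ)) ⟨x.1.fst, x.1.adj.symm⟩), m)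

/-- The same passage of the same face along the same edge, seen in the opposite direction. -/
def reverse (S : EmbeddingScheme G) (x : Flag G) : Flag G :=
  (x.1.symm, -(x.2 * S.dartSign x.1))

/-- The facial walks, up to the choice of the starting point and of the direction: the classes of
the equivalence relation that is generated by `x ∼ next x` and `x ∼ reverse x`. -/
def FacialWalk (S : EmbeddingScheme G) : Type _ :=
  Quot fun x y : Flag G => y = S.next x ∨ y = S.reverse x

/-- The number of faces. A vertex without neighbours carries one facial walk of length `0`
(so that the one-vertex graph has one face). -/
noncomputable def numFaces (S : EmbeddingScheme G) : ℕ :=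
  Nat.card S.FacialWalk + Nat.card {v : V // G.neighborSet v = ∅}

/-- The Euler characteristic `|V| - |E| + |F|` of the surface of the scheme (of a finite graph). -/
noncomputable def eulerChar (S : EmbeddingScheme G) : ℤ :=
  (Nat.card V : ℤ) - (Nat.card G.edgeSet : ℤ) + (S.numFaces : ℤ)

/-- The surface of the scheme is orientable: the scheme can be switched to the trivial signature by
reversing the local rotations at some vertices (those with `s v = -1`). Equivalently, every cycle
has an even number of edges of signature `-1`. -/
def IsOrientable (S : EmbeddingScheme G) : Prop :=
  ∃ s : V → ℤˣ, ∀ d : G.Dart, S.dartSign d = s d.fst * s d.snd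

end EmbeddingScheme

namespace SimpleGraph

variable {V : Type*}

/-- `G` has a 2-cell embedding in the orientable surface `𝕊_h` of genus `h`, the one of Euler
characteristic `2 - 2h`. -/
def CellEmbedsOrientable (G : SimpleGraph V) (h : ℕ) : Prop :=
  G.Connected ∧ ∃ S : EmbeddingScheme G, S.IsOrientable ∧ S.eulerChar = 2 - 2 * (h : ℤ)

/-- `G` has a 2-cell embedding in the non-orientable surface `ℕ_c` with crosscap number `c`, the
one of Euler characteristic `2 - c`. -/
def CellEmbedsNonorientable (G : SimpleGraph V) (c : ℕ) : Prop :=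
  G.Connected ∧ ∃ S : EmbeddingScheme G, ¬ S.IsOrientable ∧ S.eulerChar = 2 - (c : ℤ)

/-- The (orientable) genus of a finite connected graph: the least `h` such that the graph has a
2-cell embedding in the orientable surface of genus `h`; it is `⊤` if there is no such `h`. -/
noncomputable def orientableGenus (G : SimpleGraph V) : ℕ∞ :=
  ⨅ (h : ℕ) (_ : G.CellEmbedsOrientable h), (h : ℕ∞)

/-- The non-orientable genus of a finite connected graph: `0` if the graph is planar, and otherwise
the least `c` such that the graph has a 2-cell embedding in the non-orientable surface with
crosscap number `c`; it is `⊤` if there is no such `c`. -/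
noncomputable def nonorientableGenus (G : SimpleGraph V) : ℕ∞ :=
  open Classical in
  if G.CellEmbedsOrientable 0 then 0
  else ⨅ (c : ℕ) (_ : G.CellEmbedsNonorientable c), (c : ℕ∞)

end SimpleGraph

namespace Hypergraph

variable {α : Type*}

/-- The Levi graph of a hypergraph: its vertices are the vertices and the edges of the hypergraph,
and `v` is adjacent to `e` if and only if `v ∈ e`. -/
def leviGraph (H : Hypergraph α) : SimpleGraph (H.vertexSet ⊕ H.edgeSet) where
  Adj
    | .inl v, .inr e => v.1 ∈ e.1
    | .inr e, .inl v => v.1 ∈ e.1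
    | _, _ => False
  symm := ⟨by rintro (v | e) (w | f) h <;> exact h⟩
  loopless := ⟨by rintro (v | e) h <;> exact h⟩

/-- The (orientable) genus of a hypergraph is the genus of its Levi graph. -/
noncomputable def orientableGenus (H : Hypergraph α) : ℕ∞ :=
  H.leviGraph.orientableGenus

/-- The non-orientable genus of a hypergraph is the non-orientable genus of its Levi graph. -/
noncomputable def nonorientableGenus (H : Hypergraph α) : ℕ∞ :=
  H.leviGraph.nonorientableGenus

/-- The complete 3-uniform hypergraph `K_n^3`: `n` vertices, and every set of three vertices is an
edge. -/
def completeThreeUniform (n : ℕ) : Hypergraph (Fin n) where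
  vertexSet := Set.univ
  edgeSet := {e | e.ncard = 3}
  subset_vertexSet_of_mem_edgeSet' := fun e _ => Set.subset_univ e

end Hypergraph

/-! The lower bounds are Euler's formula: the Levi graph is bipartite and has no vertex of degree
one, so every face has length at least four, and twice the Euler characteristic is at most `2n -
n.choose 3` (`two_mul_eulerChar_le`). Equality holds when every face is a quadrangle, so what is
needed is a quadrangular embedding, orientable for the first formula and non-orientable for the
second.

In such an embedding the rotation at a point `a` lists the triples containing `a`, that is, the
edges of the complete graph on the other points. The rotations used here are closed Eulerian trails
of that graph. If the trail of `a` passes `c, b, d` exactly when the trail of `b` passes `c, a, d`,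
then `a, abc, b, abd` bounds a quadrangle. Such a family is a `TrailSystem`; `TrailSystem.scheme`
turns it into an embedding scheme, with all faces quadrangles by `TrailSystem.next_four`. The scheme
is orientable exactly when the trails can be reversed so that their directions come from cyclic
orders of the triples.

Trail systems are built by induction, from the tetrahedron, adding two points at a time. The old
points form pairs of partners. The trails of the two new points come from two Eulerian trails of one
regular tournament on the old points and one further point, which stands for the other new point.
Compatibility then dictates the new transitions in the trail of an old point `a`. The new arcs form
a single closed trail because the transitions of the two tournament trails at `a` differ by a cyclic
permutation (`exists_trails`). This closed trail is spliced into the old trail of `a` at the partner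
of `a`; a single exchange of transitions does this for both partners (`joinMate_eq`). Each pair may
choose the direction `ε` of its new arcs: the constant choice `1` keeps the system oriented, and a
non-constant choice makes it non-orientable. -/

section

open Equiv Equiv.Perm

/-! ### Merging and splitting cycles of permutations by transpositions -/

namespace Equiv.Perm

variable {α : Type*} [Finite α] {f g : Perm α} {p q : α}

/-- The walk starts at `f p` and reaches `p` only when the orbit closes, so `P p` is a conclusion
and no step out of `p` has to be justified. -/
theorem sameCycle_induction {P : α → Prop} (h0 : P (f p)) (h : ∀ z, f.SameCycle p z → z ≠ p → P z → P (f z))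
    {z : α} (hz : f.SameCycle p z) : P z := by
  obtain ⟨k, hk, -, rfl⟩ := hz.exists_pow_eq''
  clear hz
  induction k with
  | zero => omega
  | succ k ih =>
    rw [pow_succ', mul_apply]
    by_cases hk' : (f ^ k) p = p
    · rwa [hk']
    · rcases Nat.eq_zero_or_pos k with rfl | hk0
      · simpa using h0
      · refine h _ ⟨k, by simp⟩ hk' (ih hk0)

/-- From `p`, the map `g` enters the `f`-cycle of `q` at `f q` and then follows `f` until it reaches
`q`, so it collects the whole cycle. -/
theorem sameCycle_of_apply_eq_apply (hp : g p = f q)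
    (h : ∀ z, f.SameCycle q z → z ≠ q → g z = f z) {z : α} (hz : f.SameCycle q z) :
    g.SameCycle p z := by
  refine sameCycle_induction (P := fun z => g.SameCycle p z) ?_ ?_ hz
  · rw [← hp]; exact ⟨1, by simp⟩
  · intro w hw hwq hgw
    rw [← h w hw hwq]
    exact sameCycle_apply_right.2 hgw

/-- Exchanging the images of two points in different cycles merges the two cycles. -/
theorem sameCycle_merge (hpq : ¬ f.SameCycle p q) (hp : g p = f q) (hq : g q = f p)
    (h : ∀ z, f.SameCycle p z ∨ f.SameCycle q z → z ≠ p → z ≠ q → g z = f z) {z : α}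
    (hz : f.SameCycle p z ∨ f.SameCycle q z) : g.SameCycle p z := by
  have hqp : ¬ f.SameCycle q p := fun h => hpq h.symm
  have h1 : ∀ {z}, f.SameCycle q z → g.SameCycle p z :=
    sameCycle_of_apply_eq_apply hp fun w hw hwq =>
      h w (Or.inr hw) (fun e => hqp (e ▸ hw)) hwq
  have h2 : ∀ {z}, f.SameCycle p z → g.SameCycle q z :=
    sameCycle_of_apply_eq_apply hq fun w hw hwp =>
      h w (Or.inl hw) hwp (fun e => hpq (e ▸ hw))
  rcases hz with hz | hz
  · exact (h1 (SameCycle.refl _ _)).trans (h2 hz)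
  · exact h1 hz

variable [DecidableEq α]

theorem sameCycle_mul_swap (hpq : ¬ f.SameCycle p q) {z : α}
    (hz : f.SameCycle p z ∨ f.SameCycle q z) : (f * swap p q).SameCycle p z := by
  refine sameCycle_merge hpq (by simp) (by simp) (fun z _ h1 h2 => ?_) hz
  simp [swap_apply_of_ne_of_ne h1 h2]

/-- Exchanging the images of two points of one cycle splits it. -/
theorem not_sameCycle_mul_swap (hpq : f.SameCycle p q) (hne : p ≠ q) :
    ¬ (f * swap p q).SameCycle p q := by
  classical
  have hex : ∃ j, (f ^ j) p = q := by
    obtain ⟨k, -, hk⟩ := hpq.exists_pow_eq'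
    exact ⟨k, hk⟩
  set j := Nat.find hex with hj
  have hjq : (f ^ j) p = q := Nat.find_spec hex
  have hj0 : 0 < j := by
    rcases Nat.eq_zero_or_pos j with h | h
    · rw [h] at hjq; exact absurd (by simpa using hjq) hne
    · exact h
  have hmin : ∀ i, 0 < i → i ≤ j → (f ^ i) p ≠ p := by
    intro i hi hij he
    rcases hij.lt_or_eq with h | rfl
    · refine Nat.find_min hex (m := j - i) (by omega) ?_
      rw [← hjq, show j = (j - i) + i by omega, pow_add, mul_apply, he]
      simp
    · exact hne (he.symm.trans hjq)
  have key : ∀ z, (f * swap p q).SameCycle q z → ∃ i, 0 < i ∧ i ≤ j ∧ (f ^ i) p = z := by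
    intro z hz
    refine sameCycle_induction (P := fun z => ∃ i, 0 < i ∧ i ≤ j ∧ (f ^ i) p = z) ?_ ?_ hz
    · exact ⟨1, one_pos, hj0, by simp⟩
    · rintro w - hw ⟨i, hi, hij, rfl⟩
      have : i ≠ j := by rintro rfl; exact hw hjq
      refine ⟨i + 1, by omega, by omega, ?_⟩
      rw [mul_apply, swap_apply_of_ne_of_ne (hmin i hi hij) hw, pow_succ', mul_apply]
  intro h
  obtain ⟨i, hi, hij, he⟩ := key p h.symm
  exact hmin i hi hij he

theorem sameCycle_or_of_mul_swap {z : α} (hz : f.SameCycle p z) :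
    (f * swap p q).SameCycle p z ∨ (f * swap p q).SameCycle q z := by
  have step : ∀ w, (f * swap p q).SameCycle w (f (swap p q w)) := fun w => ⟨1, by simp⟩
  refine sameCycle_induction
    (P := fun z => (f * swap p q).SameCycle p z ∨ (f * swap p q).SameCycle q z) ?_ ?_ hz
  · right; simpa using step q
  · intro w _ hwp h
    by_cases hwq : w = q
    · subst hwq; left; simpa using step p
    · have := step w
      rw [swap_apply_of_ne_of_ne hwp hwq] at this
      exact h.imp (fun h => h.trans this) (fun h => h.trans this)

/-- The permutation has only one cycle, fixed points included. -/
def IsTransitive {α : Type*} (f : Perm α) : Prop := ∀ x y, f.SameCycle x y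

theorem isTransitive_of_forall {α : Type*} {f : Perm α} {p : α} (h : ∀ z, f.SameCycle p z) : IsTransitive f :=
  fun x y => (h x).symm.trans (h y)

/-- The first swap splits the cycle with `p` and `q` in different pieces. The point `r` lies in one
of them, and swapping it with whichever of `p`, `q` lies in the other piece rejoins them. -/
theorem IsTransitive.three (hf : IsTransitive f) {p q r : α} (hpq : p ≠ q) :
    IsTransitive (f * (swap p q * swap q r)) ∨ IsTransitive (f * (swap p q * swap p r)) := by
  have hn := not_sameCycle_mul_swap (hf p q) hpq
  have hall : ∀ z, (f * swap p q).SameCycle p z ∨ (f * swap p q).SameCycle q z :=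
    fun z => sameCycle_or_of_mul_swap (hf p z)
  simp only [← mul_assoc]
  rcases hall r with hr | hr
  · left
    have h2 : ¬ (f * swap p q).SameCycle q r := fun h => hn (hr.trans h.symm)
    exact isTransitive_of_forall (p := q) fun z =>
      sameCycle_mul_swap h2 ((hall z).symm.imp id fun h => hr.symm.trans h)
  · right
    have h2 : ¬ (f * swap p q).SameCycle p r := fun h => hn (h.trans hr.symm)
    exact isTransitive_of_forall (p := p) fun z =>
      sameCycle_mul_swap h2 ((hall z).imp id fun h => hr.symm.trans h)

/-- Two interlaced swaps preserve the property of having a single cycle. -/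
theorem IsTransitive.interlaced (hf : IsTransitive f) {a a' b b' c : α} (ha : f a = b)
    (hb' : f b' = c) (hc : f c = a) (haa : a' ≠ a) (hb'a : b' ≠ a) (hb'a' : b' ≠ a') (hca : c ≠ a)
    (hca' : c ≠ a') : IsTransitive (f * swap a' a * swap b' b) := by
  have hn := not_sameCycle_mul_swap (hf a' a) haa
  have hall : ∀ z, (f * swap a' a).SameCycle a' z ∨ (f * swap a' a).SameCycle a z :=
    fun z => sameCycle_or_of_mul_swap (hf a' z)
  -- After the first swap `b` lies in the piece of `a'`, while the path `b' → c → a` survives and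
  -- puts `b'` in the piece of `a`. Hence the second swap merges the pieces.
  have h1 : (f * swap a' a).SameCycle a' b := ⟨1, by simp [ha]⟩
  have h2 : (f * swap a' a).SameCycle b' a := by
    refine ⟨2, ?_⟩
    rw [zpow_ofNat, pow_two, mul_apply, mul_apply f _ b', swap_apply_of_ne_of_ne hb'a' hb'a, hb',
      mul_apply, swap_apply_of_ne_of_ne hca' hca, hc]
  refine isTransitive_of_forall (p := b') fun z =>
    sameCycle_mul_swap (fun h => hn (h1.trans (h.symm.trans h2))) ?_
  exact (hall z).symm.imp (fun h => h2.trans h) (fun h => h1.symm.trans h)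

end Equiv.Perm

/-! ### Changing the transitions of a trail at one place -/

namespace Equiv.Perm

variable {W K : Type*} [DecidableEq W] [DecidableEq K]

theorem prodCongrRight_mul_swap (σ : W → Perm K) (w : W) (k l : K) :
    (prodCongrRight σ : Perm (W × K)) * swap (w, k) (w, l) =
      prodCongrRight (Function.update σ w (σ w * swap k l)) := by
  ext1 ⟨u, j⟩
  by_cases hu : u = w
  · subst hu
    by_cases hk : j = k
    · subst hk; simp
    · by_cases hl : j = l
      · subst hl; simp
      · rw [mul_apply, swap_apply_of_ne_of_ne (by simp [hk]) (by simp [hl])]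
        simp [swap_apply_of_ne_of_ne hk hl]
  · rw [mul_apply, swap_apply_of_ne_of_ne (by simp [hu]) (by simp [hu])]
    simp [hu]

theorem prodCongrRight_mul_swap_mul_swap (σ : W → Perm K) (w : W) (k l k' l' : K) :
    (prodCongrRight σ : Perm (W × K)) * (swap (w, k) (w, l) * swap (w, k') (w, l')) =
      prodCongrRight (Function.update σ w (σ w * (swap k l * swap k' l'))) := by
  rw [← mul_assoc, prodCongrRight_mul_swap, prodCongrRight_mul_swap]
  simp [mul_assoc]

/-- A cycle on a set extends by a transposition with a new point. -/
theorem sameCycle_mul_swap_insert [Finite K] {π : Perm K} {S : Finset K} (hfix : ∀ k, k ∉ S → π k = k)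
    (hS : ∀ k ∈ S, ∀ l ∈ S, π.SameCycle k l) {s t : K} (hs : s ∈ S) (ht : t ∉ S) :
    (∀ k, k ∉ insert t S → (π * swap s t) k = k) ∧
      ∀ k ∈ insert t S, ∀ l ∈ insert t S, (π * swap s t).SameCycle k l := by
  constructor
  · intro k hk
    rw [Finset.mem_insert, not_or] at hk
    rw [mul_apply, swap_apply_of_ne_of_ne _ hk.1, hfix _ hk.2]
    rintro rfl; exact hk.2 hs
  · have hst : ¬ π.SameCycle s t := fun h => by
      have := (h.symm.eq_of_left (hfix t ht))
      exact ht (this ▸ hs)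
    have : ∀ k ∈ insert t S, (π * swap s t).SameCycle s k := fun k hk => by
      refine sameCycle_mul_swap hst ?_
      rcases Finset.mem_insert.1 hk with rfl | hk
      · exact Or.inr (SameCycle.refl _ _)
      · exact Or.inl (hS _ hs _ hk)
    exact fun k hk l hl => (this k hk).symm.trans (this l hl)

/-- An odd number of passages of a closed trail at one place can be permuted cyclically such that
the trail stays in one piece. -/
theorem exists_cycle_isTransitive [Finite W] [Finite K] {Z : Perm (W × K)} {σ : W → Perm K}
    (hσ : IsTransitive (Z * prodCongrRight σ)) (w : W) (r : ℕ) (S : Finset K)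
    (hr : S.card = 2 * r + 1) :
    ∃ π : Perm K, (∀ k, k ∉ S → π k = k) ∧ (∀ k ∈ S, ∀ l ∈ S, π.SameCycle k l) ∧
      IsTransitive (Z * prodCongrRight (Function.update σ w (σ w * π))) := by
  induction r generalizing S with
  | zero =>
    obtain ⟨k, rfl⟩ := Finset.card_eq_one.1 hr
    refine ⟨1, fun _ _ => rfl, ?_, by simpa using hσ⟩
    simp
  | succ r ih =>
    -- A swap alone breaks the trail, so points are absorbed two at a time. Both forms offered by
    -- `three` attach `v` and then `u` to the cycle on the remaining points.
    obtain ⟨u, hu⟩ : S.Nonempty := Finset.card_pos.1 (by omega)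
    have hc1 := Finset.card_erase_of_mem hu
    obtain ⟨v, hv⟩ : (S.erase u).Nonempty := Finset.card_pos.1 (by omega)
    have hc2 := Finset.card_erase_of_mem hv
    obtain ⟨π, h1, h2, h3⟩ := ih ((S.erase u).erase v) (by omega)
    obtain ⟨s, hs⟩ : ((S.erase u).erase v).Nonempty := Finset.card_pos.1 (by omega)
    have hvS : v ∉ (S.erase u).erase v := by simp
    have e1 : insert v ((S.erase u).erase v) = S.erase u := Finset.insert_erase hv
    obtain ⟨h4, h5⟩ := sameCycle_mul_swap_insert h1 h2 hs hvS
    rw [e1] at h4 h5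
    have hne : s ≠ v := by rintro rfl; exact hvS hs
    have hsu : s ∈ S.erase u := Finset.mem_of_mem_erase hs
    have huS : u ∉ S.erase u := by simp
    have e2 : insert u (S.erase u) = S := Finset.insert_erase hu
    rcases h3.three (p := (w, s)) (q := (w, v)) (r := (w, u)) (by simpa using hne) with h | h
    · obtain ⟨h6, h7⟩ := sameCycle_mul_swap_insert h4 h5 hv huS
      rw [e2] at h6 h7
      refine ⟨_, h6, h7, ?_⟩
      rw [mul_assoc, prodCongrRight_mul_swap_mul_swap] at h
      simpa [mul_assoc] using h
    · obtain ⟨h6, h7⟩ := sameCycle_mul_swap_insert h4 h5 hsu huS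
      rw [e2] at h6 h7
      refine ⟨_, h6, h7, ?_⟩
      rw [mul_assoc, prodCongrRight_mul_swap_mul_swap] at h
      simpa [mul_assoc] using h

end Equiv.Perm

/-! ### The regular tournament -/

/-- A regular tournament on `2m + 1` points: the pairs `(j, false)`, `(j, true)` and one more point
`none`. The value `nbr w true k` is the `k`-th out-neighbour, `nbr w false k` the `k`-th
in-neighbour of `w`. -/
def nbr {m : ℕ} : Option (Fin m × Bool) → Bool → Fin m → Option (Fin m × Bool)
  | none, d, k => some (k, !d)
  | some (j, β), d, k =>
    if k < j then some (k, β ^^ d) else if j < k then some (k, !(β ^^ d))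
    else if β = d then none else some (j, d)

/-- The direction of the arc between two points: `true` if it goes from the first to the second. -/
def dir {m : ℕ} : Option (Fin m × Bool) → Option (Fin m × Bool) → Bool
  | none, none => true
  | none, some (_, γ) => !γ
  | some (_, β), none => β
  | some (j, β), some (k, γ) => if k < j then β ^^ γ else if j < k then !(β ^^ γ) else γ

/-- The position of the second point among the neighbours of the first. -/
def pos {m : ℕ} [NeZero m] : Option (Fin m × Bool) → Option (Fin m × Bool) → Fin m
  | none, none => 0
  | none, some (k, _) => k
  | some (j, _), none => j
  | some _, some (k, _) => k

section tournament

variable {m : ℕ}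

theorem nbr_ne (w : Option (Fin m × Bool)) (d : Bool) (k : Fin m) : nbr w d k ≠ w := by
  rcases w with _ | ⟨j, β⟩ <;> grind [nbr]

theorem dir_nbr (w : Option (Fin m × Bool)) (d : Bool) (k : Fin m) : dir w (nbr w d k) = d := by
  rcases w with _ | ⟨j, β⟩
  · simp [nbr, dir]
  · rcases lt_trichotomy k j with h | h | h
    · simp [nbr, dir, h]
    · subst h; cases β <;> cases d <;> simp [nbr, dir]
    · simp [nbr, dir, h, h.not_gt]


theorem dir_swap {w u : Option (Fin m × Bool)} (h : u ≠ w) : dir u w = !dir w u := by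
  rcases w with _ | ⟨j, β⟩ <;> rcases u with _ | ⟨k, γ⟩
  · exact absurd rfl h
  · simp [dir]
  · simp [dir]
  · rcases lt_trichotomy k j with h' | h' | h'
    · simp [dir, h', h'.not_gt, Bool.xor_comm]
    · subst h'; cases β <;> cases γ <;> simp_all [dir]
    · simp [dir, h', h'.not_gt, Bool.xor_comm]

variable [NeZero m]

theorem pos_nbr (w : Option (Fin m × Bool)) (d : Bool) (k : Fin m) : pos w (nbr w d k) = k := by
  rcases w with _ | ⟨j, β⟩
  · simp [nbr, pos]
  · rcases lt_trichotomy k j with h | h | h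
    · simp [nbr, pos, h]
    · subst h; cases β <;> cases d <;> simp [nbr, pos]
    · simp [nbr, pos, h, h.not_gt]

theorem nbr_dir_pos {w u : Option (Fin m × Bool)} (h : u ≠ w) : nbr w (dir w u) (pos w u) = u := by
  rcases w with _ | ⟨j, β⟩ <;> rcases u with _ | ⟨k, γ⟩
  · exact absurd rfl h
  · simp [nbr, dir, pos]
  · simp [nbr, dir, pos]
  · rcases lt_trichotomy k j with h' | h' | h'
    · simp [nbr, dir, pos, h']
    · subst h'; cases β <;> cases γ <;> simp_all [nbr, dir, pos]
    · simp [nbr, dir, pos, h', h'.not_gt]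

theorem nbr_nbr (w : Option (Fin m × Bool)) (d : Bool) (k : Fin m) :
    nbr (nbr w d k) (!d) (pos (nbr w d k) w) = w := by
  have := nbr_dir_pos (nbr_ne w d k).symm
  rwa [dir_swap (nbr_ne w d k), dir_nbr] at this

/-- The pair `(w, k)` stands for the arc from the `k`-th in-neighbour of `w` to `w`; it is mapped to
the arc from `w` to its `k`-th out-neighbour. -/
def arcNext : Perm (Option (Fin m × Bool) × Fin m) where
  toFun p := (nbr p.1 true p.2, pos (nbr p.1 true p.2) p.1)
  invFun p := (nbr p.1 false p.2, pos (nbr p.1 false p.2) p.1)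
  left_inv p := by
    have := nbr_nbr p.1 true p.2
    simp only [Bool.not_true] at this
    ext1 <;> simp [this, pos_nbr]
  right_inv p := by
    have := nbr_nbr p.1 false p.2
    simp only [Bool.not_false] at this
    ext1 <;> simp [this, pos_nbr]

theorem arcNext_apply (w : Option (Fin m × Bool)) (k : Fin m) :
    arcNext (w, k) = (nbr w true k, pos (nbr w true k) w) := rfl

theorem arcNext_pos {u w : Option (Fin m × Bool)} (h : u ≠ w) (hd : dir u w = true) :
    arcNext (u, pos u w) = (w, pos w u) := by
  have := nbr_dir_pos h.symm
  rw [hd] at this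
  rw [arcNext_apply, this]

/-! ### Closed Eulerian trails of the tournament -/

/-- A trail: at each point `w` the arc from the `k`-th in-neighbour is followed by the arc to the
out-neighbour number `σ w k`. -/
def trail (σ : Option (Fin m × Bool) → Perm (Fin m)) : Perm (Option (Fin m × Bool) × Fin m) :=
  arcNext * prodCongrRight σ

theorem trail_apply (σ : Option (Fin m × Bool) → Perm (Fin m)) (w : Option (Fin m × Bool))
    (k : Fin m) : trail σ (w, k) = arcNext (w, σ w k) := rfl

theorem trail_mul_swap (σ : Option (Fin m × Bool) → Perm (Fin m)) (w : Option (Fin m × Bool))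
    (k l : Fin m) :
    trail σ * swap (w, k) (w, l) = trail (Function.update σ w (σ w * swap k l)) := by
  rw [trail, mul_assoc, Equiv.Perm.prodCongrRight_mul_swap]; rfl


/-- The constraints prescribe the passages `none → (i, false) → (i, true)` and, at `none`, `(i,
true) → none → (i, false)`. Among the admissible transitions, one is chosen whose cycle through a
root is largest; maximality forces this cycle to contain everything. -/
theorem exists_trail (hm : 2 ≤ m) : ∃ σ : Option (Fin m × Bool) → Perm (Fin m),
    σ none = 1 ∧ (∀ i, σ (some (i, false)) i = i) ∧ (trail σ).IsTransitive := by
  classical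
  let r : Option (Fin m × Bool) × Fin m := (some (0, true), 0)
  let A := {σ : Option (Fin m × Bool) → Perm (Fin m) // σ none = 1 ∧ ∀ i, σ (some (i, false)) i = i}
  have : Nonempty A := ⟨⟨fun _ => 1, rfl, fun _ => rfl⟩⟩
  obtain ⟨⟨σ, hσ1, hσ2⟩, hmax⟩ :=
    Finite.exists_max fun σ : A => Nat.card {p // (trail σ.1).SameCycle r p}
  refine ⟨σ, hσ1, hσ2, ?_⟩
  -- Swapping a passage inside the cycle of `r` with one outside it at the same point would enlarge
  -- the cycle. Prescribed passages are excluded since a swap must not touch them.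
  have merge : ∀ (v : Fin m × Bool) (k l : Fin m), ¬ (v.2 = false ∧ k = v.1) →
      ¬ (v.2 = false ∧ l = v.1) → (trail σ).SameCycle r (some v, k) →
      (trail σ).SameCycle r (some v, l) := by
    intro v k l hk hl hrk
    by_contra hrl
    have hA : Function.update σ (some v) (σ (some v) * swap k l) none = 1 ∧
        ∀ i, Function.update σ (some v) (σ (some v) * swap k l) (some (i, false)) i = i := by
      refine ⟨by simpa using hσ1, fun i => ?_⟩
      by_cases hv : v = (i, false)
      · subst hv
        have h1 : i ≠ k := fun h => hk ⟨rfl, h.symm⟩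
        have h2 : i ≠ l := fun h => hl ⟨rfl, h.symm⟩
        simp [swap_apply_of_ne_of_ne h1 h2, hσ2]
      · rw [Function.update_of_ne (by simpa [eq_comm] using hv), hσ2]
    refine absurd (hmax ⟨_, hA⟩) (not_le.2 ?_)
    have hkl : ¬ (trail σ).SameCycle (some v, k) (some v, l) := fun h => hrl (hrk.trans h)
    have hnew : ∀ {z}, (trail σ).SameCycle (some v, k) z ∨ (trail σ).SameCycle (some v, l) z →
        (trail σ * swap (some v, k) (some v, l)).SameCycle r z := fun hz =>
      (sameCycle_mul_swap hkl (Or.inl hrk.symm)).symm.trans (sameCycle_mul_swap hkl hz)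
    simp only [← trail_mul_swap]
    refine Set.ncard_lt_ncard (s := {p | (trail σ).SameCycle r p})
      (t := {p | (trail σ * swap (some v, k) (some v, l)).SameCycle r p}) ⟨?_, ?_⟩ (Set.toFinite _)
    · exact fun z hz => hnew (Or.inl (hrk.symm.trans hz))
    · exact fun h => hrl (h (hnew (Or.inr (SameCycle.refl _ _))))
  have inv : ∀ (v : Fin m × Bool) (l : Fin m), l ≠ v.1 →
      ¬ (v.2 = false ∧ (σ (some v)).symm l = v.1) := by
    rintro ⟨i, β⟩ l hl ⟨h1, h2⟩
    simp only at h1 h2 hl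
    subst h1
    rw [Equiv.symm_apply_eq, hσ2] at h2
    exact hl h2
  have step : ∀ v l, (trail σ).SameCycle (v, (σ v).symm l) (arcNext (v, l)) :=
    fun v l => ⟨1, by simp [trail_apply]⟩
  let good (v : Fin m × Bool) : Prop :=
    ∀ k, ¬ (v.2 = false ∧ k = v.1) → (trail σ).SameCycle r (some v, k)
  have good_of : ∀ (v : Fin m × Bool) (k : Fin m), ¬ (v.2 = false ∧ k = v.1) →
      (trail σ).SameCycle r (some v, k) → good v := fun v k hk h l hl => merge v k l hk hl h
  -- The arc between points of different pairs leaves and enters through passages that are not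
  -- prescribed (`inv`), so it carries goodness in either direction.
  have spread : ∀ u v : Fin m × Bool, u.1 ≠ v.1 → good u → good v := by
    intro u v huv hu
    have hne : some u ≠ some v := by simpa using fun h => huv (congrArg _ h)
    rcases hd : dir (some u) (some v) with _ | _
    · have hd' : dir (some v) (some u) = true := by rw [dir_swap hne.symm, hd]; rfl
      have h := arcNext_pos hne.symm hd'
      refine good_of v _ (inv v u.1 huv) (SameCycle.trans ?_ (step _ _).symm)
      change arcNext (some v, u.1) = (some u, v.1) at h
      rw [h]
      exact hu _ fun h => huv h.2.symm
    · have h := arcNext_pos hne hd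
      change arcNext (some u, v.1) = (some v, u.1) at h
      refine good_of v u.1 (fun h => huv h.2) ?_
      rw [← h]
      exact (hu _ (inv u v.1 huv.symm)).trans (step _ _)
  have hroot : good (0, true) := good_of _ 0 (by simp) (SameCycle.refl _ _)
  have hgood : ∀ v, good v := by
    intro v
    by_cases hv : v.1 = 0
    · have h1 : (⟨1, by omega⟩ : Fin m) ≠ 0 := by simp [Fin.ext_iff]
      refine spread (⟨1, by omega⟩, true) v (by rw [hv]; exact h1) (spread _ _ ?_ hroot)
      exact h1.symm
    · exact spread _ _ (Ne.symm hv) hroot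
  refine isTransitive_of_forall (p := r) ?_
  rintro ⟨_ | v, k⟩
  · have h : arcNext (some (k, true), k) = (none, k) := by simp [arcNext_apply, nbr, pos]
    rw [← h]
    exact (hgood (k, true) _ (by simp)).trans (step _ _)
  · by_cases hk : v.2 = false ∧ k = v.1
    · obtain ⟨i, β⟩ := v
      obtain ⟨rfl, rfl⟩ := hk
      refine (hgood (k, true) k (by simp)).trans (SameCycle.symm ⟨1, ?_⟩)
      simp [trail_apply, hσ2, arcNext_apply, nbr, pos]
    · exact hgood v k hk

/-- For odd `m` an `m`-cycle can be inserted at each of the two points separately. For even `m` it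
is an odd permutation, so an `(m - 1)`-cycle avoiding position `i` is inserted at each point, and
the two missing swaps are made together as an interlaced pair. The prescribed path `none → (i,
false) → (i, true)` provides the interlacing. -/
theorem exists_trail_pair (hm : 2 ≤ m) (σ : Option (Fin m × Bool) → Perm (Fin m)) (i : Fin m)
    (h0 : σ none = 1) (hi : σ (some (i, false)) i = i) (hσ : (trail σ).IsTransitive) :
    ∃ τ : Option (Fin m × Bool) → Perm (Fin m), (trail τ).IsTransitive ∧
      (∀ w, w ≠ some (i, false) → w ≠ some (i, true) → τ w = σ w) ∧
      ∀ β, ((σ (some (i, β)))⁻¹ * τ (some (i, β))).IsTransitive := by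
  classical
  have hab : (some (i, true) : Option (Fin m × Bool)) ≠ some (i, false) := by simp
  rcases Nat.even_or_odd' m with ⟨r, hr | hr⟩
  · have hcard : (Finset.univ.erase i : Finset (Fin m)).card = 2 * (r - 1) + 1 := by
      rw [Finset.card_erase_of_mem (Finset.mem_univ _), Finset.card_univ, Fintype.card_fin]; omega
    obtain ⟨π, h1, h2, h3⟩ := exists_cycle_isTransitive hσ (some (i, false)) _ _ hcard
    obtain ⟨ρ, h4, h5, h6⟩ := exists_cycle_isTransitive h3 (some (i, true)) _ _ hcard
    rw [Function.update_of_ne hab] at h6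
    set τ := Function.update (Function.update σ (some (i, false)) (σ (some (i, false)) * π))
      (some (i, true)) (σ (some (i, true)) * ρ) with hτ
    change (trail τ).IsTransitive at h6
    have τa : τ (some (i, false)) = σ (some (i, false)) * π := by
      rw [hτ, Function.update_of_ne hab.symm, Function.update_self]
    have τb : τ (some (i, true)) = σ (some (i, true)) * ρ := by
      rw [hτ, Function.update_self]
    have τ0 : τ none = 1 := by
      rw [hτ, Function.update_of_ne (by simp), Function.update_of_ne (by simp), h0]
    obtain ⟨l, hl⟩ : (Finset.univ.erase i : Finset (Fin m)).Nonempty :=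
      Finset.card_pos.1 (by omega)
    -- The passage through `(i, true)` that continues to `none`.
    obtain ⟨k, hk⟩ : ∃ k, τ (some (i, true)) k = i := ⟨(τ (some (i, true))).symm i, by simp⟩
    have fa : trail τ (some (i, false), i) = (some (i, true), i) := by
      rw [trail_apply, τa, mul_apply, h1 i (by simp), hi]
      simp [arcNext_apply, nbr, pos]
    have fb : trail τ (some (i, true), k) = (none, i) := by
      rw [trail_apply, hk]; simp [arcNext_apply, nbr, pos]
    have fc : trail τ (none, i) = (some (i, false), i) := by
      rw [trail_apply, τ0]; simp [arcNext_apply, nbr, pos]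
    -- If `k = i`, the trail would close up after the triangle `none`, `(i, false)`, `(i, true)` and
    -- miss the passage `(none, l)`.
    have hki : k ≠ i := by
      rintro rfl
      have hl' : l ≠ k := by simpa using hl
      have key : ∀ z, (trail τ).SameCycle (none, k) z →
          z = (none, k) ∨ z = (some (k, false), k) ∨ z = (some (k, true), k) := by
        intro z hz
        refine sameCycle_induction (P := fun z => z = (none, k) ∨ z = (some (k, false), k) ∨
          z = (some (k, true), k)) ?_ ?_ hz
        · rw [fc]; simp
        · rintro _ - - (rfl | rfl | rfl)
          · rw [fc]; simp
          · rw [fa]; simp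
          · rw [fb]; simp
      have := key _ (h6 (none, k) (none, l))
      simp [hl'] at this
    have hkm : k ∈ Finset.univ.erase i := by simpa using hki
    have h7 := h6.interlaced (a := (some (i, false), i)) (a' := (some (i, false), l))
      (b := (some (i, true), i)) (b' := (some (i, true), k)) (c := (none, i)) fa fb fc
      (by simpa using hl) (by simp) (by simp) (by simp) (by simp)
    rw [trail_mul_swap, trail_mul_swap, Function.update_of_ne hab, τa, τb] at h7
    refine ⟨_, h7, ?_, ?_⟩
    · intro w hw1 hw2
      rw [Function.update_of_ne hw2, Function.update_of_ne hw1, hτ, Function.update_of_ne hw2,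
        Function.update_of_ne hw1]
    · have ins : insert i (Finset.univ.erase i) = (Finset.univ : Finset (Fin m)) :=
        Finset.insert_erase (Finset.mem_univ _)
      rintro (_ | _)
      · have := (sameCycle_mul_swap_insert h1 h2 hl (Finset.notMem_erase i _)).2
        rw [ins] at this
        rw [Function.update_of_ne hab.symm, Function.update_self, mul_assoc, inv_mul_cancel_left]
        exact fun x y => this x (Finset.mem_univ _) y (Finset.mem_univ _)
      · have := (sameCycle_mul_swap_insert h4 h5 hkm (Finset.notMem_erase i _)).2
        rw [ins] at this
        rw [Function.update_self, mul_assoc, inv_mul_cancel_left]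
        exact fun x y => this x (Finset.mem_univ _) y (Finset.mem_univ _)
  · have hcard : (Finset.univ : Finset (Fin m)).card = 2 * r + 1 := by simpa using hr
    obtain ⟨π, -, h2, h3⟩ := exists_cycle_isTransitive hσ (some (i, false)) _ _ hcard
    obtain ⟨ρ, -, h5, h6⟩ := exists_cycle_isTransitive h3 (some (i, true)) _ _ hcard
    rw [Function.update_of_ne hab] at h6
    refine ⟨_, h6, ?_, ?_⟩
    · intro w hw1 hw2
      rw [Function.update_of_ne hw2, Function.update_of_ne hw1]
    · rintro (_ | _)
      · rw [Function.update_of_ne hab.symm, Function.update_self, inv_mul_cancel_left]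
        exact fun x y => h2 x (Finset.mem_univ _) y (Finset.mem_univ _)
      · rw [Function.update_self, inv_mul_cancel_left]
        exact fun x y => h5 x (Finset.mem_univ _) y (Finset.mem_univ _)

/-- Two closed Eulerian trails of the tournament with the same transitions at `none`, whose
transitions at every other point differ by a cyclic permutation. -/
theorem exists_trails (hm : 2 ≤ m) : ∃ σ τ : Option (Fin m × Bool) → Perm (Fin m),
    σ none = 1 ∧ τ none = 1 ∧ (trail σ).IsTransitive ∧ (trail τ).IsTransitive ∧
    ∀ v, ((σ (some v))⁻¹ * τ (some v)).IsTransitive := by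
  classical
  obtain ⟨σ, h1, h2, h3⟩ := exists_trail hm
  -- The pairs are treated one by one. Treating a pair changes transitions only at its two points,
  -- so the prescribed passages of untreated pairs remain available.
  have key : ∀ U : Finset (Fin m), ∃ τ : Option (Fin m × Bool) → Perm (Fin m),
      (trail τ).IsTransitive ∧ τ none = 1 ∧ (∀ i ∉ U, ∀ β, τ (some (i, β)) = σ (some (i, β))) ∧
      ∀ i ∈ U, ∀ β, ((σ (some (i, β)))⁻¹ * τ (some (i, β))).IsTransitive := by
    intro U
    induction U using Finset.induction_on with
    | empty => exact ⟨σ, h3, h1, by simp, by simp⟩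
    | insert i U hi ih =>
      obtain ⟨τ, k1, k2, k3, k4⟩ := ih
      obtain ⟨τ', l1, l2, l3⟩ := exists_trail_pair hm τ i k2 (by rw [k3 i hi, h2]) k1
      refine ⟨τ', l1, by rw [l2 _ (by simp) (by simp), k2], ?_, ?_⟩
      · intro j hj β
        rw [Finset.mem_insert, not_or] at hj
        rw [l2 _ (by simp [hj.1]) (by simp [hj.1]), k3 j hj.2]
      · intro j hj β
        by_cases hji : j = i
        · subst hji
          rw [← k3 j hi β]
          exact l3 β
        · rw [l2 _ (by simp [hji]) (by simp [hji])]
          exact k4 j ((Finset.mem_insert.1 hj).resolve_left hji) β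
  obtain ⟨τ, k1, k2, -, k4⟩ := key Finset.univ
  exact ⟨σ, τ, h1, k2, h3, k1, fun v => k4 v.1 (Finset.mem_univ _) v.2⟩

end tournament

/-! ### Trail systems -/

section turn

variable {V : Type*}

/-- The map that sends the arc `c → b` to the arc `b → M b c`. -/
def turn (M : V → V → V) (h : ∀ b c, M b (M b c) = c) : Perm (V × V) where
  toFun p := (p.2, M p.2 p.1)
  invFun p := (M p.1 p.2, p.1)
  left_inv p := by simp [h]
  right_inv p := by simp [h]

theorem turn_apply (M : V → V → V) (h : ∀ b c, M b (M b c) = c) (c b : V) :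
    turn M h (c, b) = (b, M b c) := rfl

theorem Equiv.Perm.SameCycle.map_of_semiconj {α β : Type*} [Finite α] {f : Perm α} {g : Perm β} (φ : α → β)
    (h : ∀ x, g (φ x) = φ (f x)) {x y : α} (hxy : f.SameCycle x y) : g.SameCycle (φ x) (φ y) := by
  obtain ⟨k, -, rfl⟩ := hxy.exists_pow_eq'
  refine ⟨k, ?_⟩
  rw [zpow_natCast]
  clear hxy
  induction k with
  | zero => rfl
  | succ k ih => rw [pow_succ', mul_apply, ih, h, pow_succ', mul_apply]

theorem Equiv.Perm.sameCycle_permCongr {α β : Type*} [Finite α] (e : α ≃ β) {f : Perm α}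
    (h : ∀ x y, f.SameCycle x y) (x y : β) : (e.permCongr f).SameCycle x y := by
  simpa using SameCycle.map_of_semiconj (g := e.permCongr f) e (by simp) (h (e.symm x) (e.symm y))

/-- Reversing arcs conjugates `turn` to its inverse, because `M b` is an involution. -/
theorem sameCycle_turn_swap [Finite V] (M : V → V → V) (h : ∀ b c, M b (M b c) = c) {p q : V × V}
    (hpq : (turn M h).SameCycle p q) : (turn M h).SameCycle p.swap q.swap := by
  rw [← sameCycle_inv] at hpq
  refine SameCycle.map_of_semiconj Prod.swap (fun x => ?_) hpq
  rw [Perm.inv_def]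
  rfl

end turn

/-- A family of closed Eulerian trails, one in the complete graph on `V \ {a}` for every `a`, such
that the trail of `a` joins `c`, `b`, `d` if and only if the trail of `b` joins `c`, `a`, `d`; in
this case `d = mate a b c`. If `sgn a c b = 1`, then the trail of `a` is directed from `c`
to `b`. -/
structure TrailSystem (V : Type*) where
  mate : V → V → V → V
  sgn : V → V → V → ℤˣ
  mate_mate : ∀ a b c, mate a b (mate a b c) = c
  mate_comm : ∀ a b, mate a b = mate b a
  mate_ne : ∀ {a b c}, a ≠ b → c ≠ a → c ≠ b → mate a b c ≠ a
  sgn_swap : ∀ {a b c}, b ≠ a → c ≠ a → b ≠ c → sgn a c b = - sgn a b c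
  sgn_mate : ∀ {a b c}, a ≠ b → c ≠ a → c ≠ b → sgn a b (mate a b c) = - sgn a b c
  sameCycle : ∀ {a c b c' b'}, c ≠ a → b ≠ a → c ≠ b → sgn a c b = 1 →
    c' ≠ a → b' ≠ a → c' ≠ b' → sgn a c' b' = 1 →
    (turn (mate a) (mate_mate a)).SameCycle (c, b) (c', b')

namespace TrailSystem

variable {V : Type*} (S : TrailSystem V)

/-- All directions are induced by cyclic orders of the triples. -/
def IsOriented : Prop := ∀ a b c, a ≠ b → b ≠ c → a ≠ c → S.sgn a b c = S.sgn b c a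

/-- Some trails may be reversed such that all directions are induced by cyclic orders of the
triples. -/
def IsOrientable : Prop :=
  ∃ t : V → ℤˣ, ∀ a b c, a ≠ b → b ≠ c → a ≠ c → t a * S.sgn a b c = t b * S.sgn b c a

theorem IsOriented.isOrientable {S : TrailSystem V} (h : S.IsOriented) : S.IsOrientable :=
  ⟨1, by simpa [IsOriented] using h⟩

theorem mate_ne_right {a b c : V} (hab : a ≠ b) (ha : c ≠ a) (hb : c ≠ b) : S.mate a b c ≠ b := by
  rw [S.mate_comm]; exact S.mate_ne hab.symm hb ha

theorem mate_ne_self {a b c : V} (hab : a ≠ b) (ha : c ≠ a) (hb : c ≠ b) : S.mate a b c ≠ c := by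
  intro h
  have := S.sgn_mate hab ha hb
  rw [h] at this
  exact units_ne_neg_self _ this

/-- Transport along a bijection. -/
def map {V' : Type*} [Finite V] (e : V' ≃ V) : TrailSystem V' where
  mate a b c := e.symm (S.mate (e a) (e b) (e c))
  sgn a b c := S.sgn (e a) (e b) (e c)
  mate_mate a b c := by simp [S.mate_mate]
  mate_comm a b := by simp [S.mate_comm (e a) (e b)]
  mate_ne h1 h2 h3 := by
    rw [Ne, Equiv.symm_apply_eq]
    exact S.mate_ne (e.injective.ne h1) (e.injective.ne h2) (e.injective.ne h3)
  sgn_swap h1 h2 h3 := S.sgn_swap (e.injective.ne h1) (e.injective.ne h2) (e.injective.ne h3)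
  sgn_mate h1 h2 h3 := by
    simpa using S.sgn_mate (e.injective.ne h1) (e.injective.ne h2) (e.injective.ne h3)
  sameCycle {a c b c' b'} h1 h2 h3 h4 h5 h6 h7 h8 := by
    have := SameCycle.map_of_semiconj
      (g := turn (fun b c => e.symm (S.mate (e a) (e b) (e c))) (by simp [S.mate_mate]))
      (fun p : V × V => (e.symm p.1, e.symm p.2)) (fun p => by simp [turn])
      (S.sameCycle (e.injective.ne h1) (e.injective.ne h2) (e.injective.ne h3) h4
        (e.injective.ne h5) (e.injective.ne h6) (e.injective.ne h7) h8)
    simpa using this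

theorem IsOriented.map {V' : Type*} [Finite V] {S : TrailSystem V} (h : S.IsOriented) (e : V' ≃ V) :
    (S.map e).IsOriented := fun _ _ _ h1 h2 h3 =>
  h _ _ _ (e.injective.ne h1) (e.injective.ne h2) (e.injective.ne h3)

theorem isOrientable_of_map {V' : Type*} [Finite V] {S : TrailSystem V} {e : V' ≃ V}
    (h : (S.map e).IsOrientable) : S.IsOrientable := by
  obtain ⟨t, ht⟩ := h
  refine ⟨t ∘ e.symm, fun a b c h1 h2 h3 => ?_⟩
  simpa [TrailSystem.map] using
    ht _ _ _ (e.symm.injective.ne h1) (e.symm.injective.ne h2) (e.symm.injective.ne h3)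

end TrailSystem

/-! ### The base case: four points -/

section base

/-- The sign of the difference of two points of `Fin 4`. -/
def diffSign (a b : Fin 4) : ℤˣ := if a < b then 1 else -1

/-- The fourth point. -/
def fourth (a b c : Fin 4) : Fin 4 :=
  -- The elements of `Fin 4` add up to `2` modulo `4`. The degenerate values are chosen to keep the
  -- map an involution in `c`.
  if a = b then c else if c = a then b else if c = b then a else 2 - a - b - c

theorem fourth_fourth : ∀ a b c, fourth a b (fourth a b c) = c := by decide

/-- The boundary of the tetrahedron. -/
def tetrahedron : TrailSystem (Fin 4) where
  mate := fourth
  -- For distinct points this is the sign of the arrangement `a, b, c, fourth a b c`; it is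
  -- invariant under rotating the first three.
  sgn a b c := diffSign a b * diffSign a c * diffSign b c * diffSign a (fourth a b c) *
    diffSign b (fourth a b c) * diffSign c (fourth a b c)
  mate_mate := fourth_fourth
  mate_comm a b := by funext c; revert a b c; decide
  mate_ne {a b c} := by revert a b c; decide
  sgn_swap {a b c} := by revert a b c; decide
  sgn_mate {a b c} := by revert a b c; decide
  sameCycle {a c b c' b'} h1 h2 h3 h4 h5 h6 h7 h8 := by
    have : ∃ k : Fin 3, (turn (fourth a) (fourth_fourth a) ^ (k : ℕ)) (c, b) = (c', b') := by
      revert a c b c' b'; decide +kernel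
    obtain ⟨k, hk⟩ := this
    exact ⟨k, by simpa using hk⟩

theorem tetrahedron_isOriented : tetrahedron.IsOriented := by
  unfold TrailSystem.IsOriented
  decide

end base

/-! ### Tournament trails as undirected transitions -/

section transitions

variable {m : ℕ} [NeZero m] (σ : Option (Fin m × Bool) → Perm (Fin m))

/-- The neighbour of `w` that follows or precedes `u` in the passages of the trail through `w`. -/
def trailMate (w u : Option (Fin m × Bool)) : Option (Fin m × Bool) :=
  if u = w then w
  else nbr w (!dir w u) (if dir w u then (σ w).symm (pos w u) else σ w (pos w u))

theorem trailMate_self (w : Option (Fin m × Bool)) : trailMate σ w w = w := by simp [trailMate]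

theorem trailMate_nbr (w : Option (Fin m × Bool)) (d : Bool) (k : Fin m) :
    trailMate σ w (nbr w d k) = nbr w (!d) (if d then (σ w).symm k else σ w k) := by
  simp [trailMate, nbr_ne, dir_nbr, pos_nbr]

theorem dir_trailMate {w u : Option (Fin m × Bool)} (h : u ≠ w) :
    dir w (trailMate σ w u) = !dir w u := by
  simp [trailMate, h, dir_nbr]

theorem trailMate_ne {w u : Option (Fin m × Bool)} (h : u ≠ w) : trailMate σ w u ≠ w := by
  simp [trailMate, h, nbr_ne]

theorem trailMate_trailMate (w u : Option (Fin m × Bool)) :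
    trailMate σ w (trailMate σ w u) = u := by
  by_cases h : u = w
  · subst h; simp [trailMate_self]
  · nth_rw 2 [trailMate]
    rw [if_neg h, trailMate_nbr]
    conv_rhs => rw [← nbr_dir_pos h]
    cases dir w u <;> simp

/-- This is why the transition at `none` is prescribed: each new point's trail passes the other new
point between partners, so the two trails are compatible there. -/
theorem trailMate_none_some (h : σ none = 1) (v : Fin m × Bool) :
    trailMate σ none (some v) = some (v.1, !v.2) := by
  simp only [trailMate, dir, pos, h, nbr]
  cases v.2 <;> rfl

/-- Reading `(w, k)` as the arc into `w` from its `k`-th in-neighbour carries `trail σ` to `turn`.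
-/
theorem sameCycle_turn_trailMate (h : (trail σ).IsTransitive) {u w u' w' : Option (Fin m × Bool)}
    (huw : u ≠ w) (hd : dir u w = true) (huw' : u' ≠ w') (hd' : dir u' w' = true) :
    (turn (trailMate σ) (trailMate_trailMate σ)).SameCycle (u, w) (u', w') := by
  have key := SameCycle.map_of_semiconj (g := turn (trailMate σ) (trailMate_trailMate σ))
    (fun p : Option (Fin m × Bool) × Fin m => (nbr p.1 false p.2, p.1)) (fun p => by
      obtain ⟨w, k⟩ := p
      have := nbr_nbr w true (σ w k)
      simp only [Bool.not_true] at this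
      rw [turn_apply, trailMate_nbr, trail_apply, arcNext_apply]
      simp [this]) (h (w, pos w u) (w', pos w' u'))
  have h1 := nbr_dir_pos huw
  have h2 := nbr_dir_pos huw'
  rw [dir_swap huw.symm, hd] at h1
  rw [dir_swap huw'.symm, hd'] at h2
  simp only [Bool.not_true] at h1 h2
  simpa [h1, h2] using key

end transitions

/-! ### Adding two points: the new transitions and directions -/

section extension

variable {m : ℕ}

/-- The other member of a pair. -/
def partner (a : Fin m × Bool) : Fin m × Bool := (a.1, !a.2)

theorem partner_partner (a : Fin m × Bool) : partner (partner a) = a := by simp [partner]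

theorem partner_ne (a : Fin m × Bool) : partner a ≠ a := by
  intro h; simpa [partner] using congrArg Prod.snd h

/-- The two signs. -/
def boolSign (β : Bool) : ℤˣ := if β then -1 else 1

theorem boolSign_not (β : Bool) : boolSign (!β) = - boolSign β := by cases β <;> simp [boolSign]

/-- The direction of an arc as a sign. -/
def dirSign (u w : Option (Fin m × Bool)) : ℤˣ := if dir u w then 1 else -1

theorem dirSign_eq_one {u w : Option (Fin m × Bool)} : dirSign u w = 1 ↔ dir u w = true := by
  unfold dirSign; split_ifs with h <;> simp [h]

theorem dirSign_eq_neg_one {u w : Option (Fin m × Bool)} : dirSign u w = -1 ↔ dir u w = false := by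
  unfold dirSign; split_ifs with h <;> simp [h]

theorem dirSign_swap {u w : Option (Fin m × Bool)} (h : u ≠ w) : dirSign w u = - dirSign u w := by
  unfold dirSign; rw [dir_swap h.symm]; cases dir u w <;> simp

theorem dirSign_trailMate [NeZero m] (σ : Option (Fin m × Bool) → Perm (Fin m))
    {w u : Option (Fin m × Bool)} (h : u ≠ w) : dirSign w (trailMate σ w u) = - dirSign w u := by
  unfold dirSign; rw [dir_trailMate σ h]; cases dir w u <;> simp

/-- The points of the tournament among the old points and the two new points, as seen from one of
the two new points. -/
def toExt (β : Bool) : Option (Fin m × Bool) → (Fin m × Bool) ⊕ Bool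
  | none => .inr !β
  | some v => .inl v

/-- The inverse of `toExt`. -/
def ofExt : (Fin m × Bool) ⊕ Bool → Option (Fin m × Bool)
  | .inl v => some v
  | .inr _ => none

theorem ofExt_toExt (β : Bool) (u : Option (Fin m × Bool)) : ofExt (toExt β u) = u := by
  rcases u with _ | u <;> rfl

theorem toExt_ofExt {β : Bool} {c : (Fin m × Bool) ⊕ Bool} (h : c ≠ .inr β) :
    toExt β (ofExt c) = c := by
  rcases c with c | γ
  · rfl
  · have : γ ≠ β := by simpa using h
    simp [ofExt, toExt, Bool.not_eq_eq_eq_not.2 (by cases β <;> cases γ <;> simp_all : β = !γ)]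

theorem toExt_ne (β : Bool) (u : Option (Fin m × Bool)) : toExt β u ≠ .inr β := by
  rcases u with _ | u <;> simp [toExt]

theorem ofExt_ne {β : Bool} {c c' : (Fin m × Bool) ⊕ Bool} (h : c ≠ .inr β) (h' : c' ≠ .inr β)
    (hne : c ≠ c') : ofExt c ≠ ofExt c' := fun e => hne <| by
  rw [← toExt_ofExt h, ← toExt_ofExt h', e]

/-- The data of the extension of a trail system by two new points: `σ` describes the trails at the
two new points, `e a` is the point from which the trail of `a` comes at the passage through the
partner of `a` where it is joined to the new arcs, and `ε` tells in which direction the new arcs are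
traversed. -/
structure ExtensionData (m : ℕ) [NeZero m] where
  S : TrailSystem (Fin m × Bool)
  oriented : S.IsOriented
  σ : Bool → Option (Fin m × Bool) → Perm (Fin m)
  σ_none : ∀ β, σ β none = 1
  trail_σ : ∀ β, (trail (σ β)).IsTransitive
  cycle_σ : ∀ v, ((σ false (some v))⁻¹ * σ true (some v)).IsTransitive
  e : Fin m × Bool → Fin m × Bool
  e_ne : ∀ a, e a ≠ a
  e_ne_partner : ∀ a, e a ≠ partner a
  e_partner : ∀ a, e (partner a) = S.mate a (partner a) (e a)
  sgn_e : ∀ a, S.sgn a (partner a) (e a) = -1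
  ε : Fin m → ℤˣ

namespace ExtensionData

variable [NeZero m] (D : ExtensionData m)

/-- The new directions. -/
def sgn : (Fin m × Bool) ⊕ Bool → (Fin m × Bool) ⊕ Bool → (Fin m × Bool) ⊕ Bool → ℤˣ
  | .inr β, u, v => boolSign β * dirSign (ofExt u) (ofExt v)
  | .inl a, .inl b, .inl c => D.S.sgn a b c
  | .inl a, .inl b, .inr β => D.ε a.1 * boolSign β * dirSign (some a) (some b)
  | .inl a, .inr β, c => D.ε a.1 * boolSign β * dirSign (ofExt c) (some a)

/-- The new transitions at old points in trails of old points, before the old and the new arcs are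
joined. -/
def preMate (a b : Fin m × Bool) : (Fin m × Bool) ⊕ Bool → (Fin m × Bool) ⊕ Bool
  | .inl c => .inl (D.S.mate a b c)
  | .inr β => .inr !β

/-- The new point to which the trail of `a` comes from its partner. -/
def z (a : Fin m × Bool) : Bool := a.2 ^^ decide (D.ε a.1 = 1)

/-- The new transitions at new points in trails of old points, and vice versa. -/
def newMate (β : Bool) (a : Fin m × Bool) (c : (Fin m × Bool) ⊕ Bool) : (Fin m × Bool) ⊕ Bool :=
  if c = .inr β then c else toExt β (trailMate (D.σ β) (some a) (ofExt c))

/-- The new transitions in the trails of two partners at the other partner. -/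
def joinMate (a b : Fin m × Bool) (c : (Fin m × Bool) ⊕ Bool) : (Fin m × Bool) ⊕ Bool :=
  swap (.inl (D.e (a.1, false))) (.inr (D.z (a.1, false)))
    (D.preMate a b (swap (.inl (D.e (a.1, false))) (.inr (D.z (a.1, false))) c))

/-- The new transitions. -/
def mate : (Fin m × Bool) ⊕ Bool → (Fin m × Bool) ⊕ Bool → (Fin m × Bool) ⊕ Bool →
    (Fin m × Bool) ⊕ Bool
  | .inl a, .inl b, c => if b = partner a then D.joinMate a b c else D.preMate a b c
  | .inl a, .inr β, c => D.newMate β a c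
  | .inr β, .inl a, c => D.newMate β a c
  | .inr _, .inr _, .inl a => .inl (partner a)
  | .inr _, .inr _, .inr γ => .inr γ

theorem preMate_preMate (a b : Fin m × Bool) (c : (Fin m × Bool) ⊕ Bool) :
    D.preMate a b (D.preMate a b c) = c := by
  rcases c with c | γ <;> simp [preMate, D.S.mate_mate]

theorem joinMate_joinMate (a b : Fin m × Bool) (c : (Fin m × Bool) ⊕ Bool) :
    D.joinMate a b (D.joinMate a b c) = c := by
  simp [joinMate, D.preMate_preMate]

theorem newMate_newMate (β : Bool) (a : Fin m × Bool) (c : (Fin m × Bool) ⊕ Bool) :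
    D.newMate β a (D.newMate β a c) = c := by
  by_cases h : c = .inr β
  · simp [newMate, h]
  · simp [newMate, h, toExt_ne, ofExt_toExt, trailMate_trailMate, toExt_ofExt]

theorem mate_mate (a b c : (Fin m × Bool) ⊕ Bool) : D.mate a b (D.mate a b c) = c := by
  rcases a with a | α <;> rcases b with b | β
  · by_cases h : b = partner a
    · simp [mate, h, joinMate_joinMate]
    · simp [mate, h, preMate_preMate]
  · exact D.newMate_newMate _ _ _
  · exact D.newMate_newMate _ _ _
  · rcases c with c | γ <;> simp [mate, partner_partner]

theorem preMate_comm (a b : Fin m × Bool) : D.preMate a b = D.preMate b a := by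
  funext c; rcases c with c | γ <;> simp [preMate, D.S.mate_comm a b]

theorem mate_comm (a b : (Fin m × Bool) ⊕ Bool) : D.mate a b = D.mate b a := by
  funext c
  rcases a with a | α <;> rcases b with b | β
  · by_cases h : b = partner a
    · subst h
      simp [mate, joinMate, partner_partner, D.preMate_comm a (partner a)]
      simp [partner]
    · have : a ≠ partner b := by rintro rfl; exact h (partner_partner b).symm
      simp [mate, h, this, D.preMate_comm a b]
  · rfl
  · rfl
  · rcases c with c | γ <;> rfl

theorem z_partner (a : Fin m × Bool) : D.z (partner a) = !D.z a := by
  change (!a.2 ^^ _) = !(a.2 ^^ _)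
  rw [Bool.not_xor]
  rfl

theorem preMate_ne {a b : Fin m × Bool} {c : (Fin m × Bool) ⊕ Bool} (hab : a ≠ b) (ha : c ≠ .inl a)
    (hb : c ≠ .inl b) : D.preMate a b c ≠ .inl a := by
  rcases c with c | γ
  · simpa [preMate] using D.S.mate_ne hab (by simpa using ha) (by simpa using hb)
  · simp [preMate]

/-- The definition singles out the partner `(i, false)`, but the result is symmetric. If an
involution pairs `e` with `e'` and `z` with `z'`, conjugating it by the swap of `e, z` or by the
swap of `e', z'` gives the same involution, pairing `e` with `z'` and `z` with `e'`. -/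
theorem joinMate_eq (a : Fin m × Bool) (c : (Fin m × Bool) ⊕ Bool) :
    D.joinMate a (partner a) c = swap (.inl (D.e a)) (.inr (D.z a))
      (D.preMate a (partner a) (swap (.inl (D.e a)) (.inr (D.z a)) c)) := by
  obtain ⟨i, β⟩ := a
  rcases β with _ | _
  · rfl
  · have h1 := D.e_partner (i, true)
    have h2 := D.z_partner (i, true)
    have h3 := (D.e_ne (i, true))
    have h4 := D.e_ne_partner (i, true)
    have h5 := D.S.mate_ne_self (partner_ne (i, true)).symm h3 h4
    have hp : partner (i, true) = (i, false) := rfl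
    simp only [joinMate]
    rw [hp] at h1 h2 h4 h5 ⊢
    rw [h1, h2]
    rcases c with c | γ
    · by_cases hc1 : c = D.e (i, true)
      · subst hc1
        simp [preMate, swap_apply_def, h5.symm]
      · by_cases hc2 : c = D.S.mate (i, true) (i, false) (D.e (i, true))
        · subst hc2
          simp [preMate, D.S.mate_mate, swap_apply_def, h5]
        · have hc3 : D.S.mate (i, true) (i, false) c ≠ D.e (i, true) := fun h => hc2 (by
            rw [← h, D.S.mate_mate])
          have hc4 : D.S.mate (i, true) (i, false) c ≠
              D.S.mate (i, true) (i, false) (D.e (i, true)) := fun h => hc1 (by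
            rw [← D.S.mate_mate (i, true) (i, false) c, h, D.S.mate_mate])
          simp [preMate, swap_apply_def, hc1, hc2, hc3, hc4]
    · by_cases hγ : γ = D.z (i, true)
      · subst hγ
        simp [preMate, swap_apply_def, h5]
      · have hγ' : γ = !D.z (i, true) := by
          revert hγ; cases γ <;> cases D.z (i, true) <;> simp
        subst hγ'
        simp [preMate, D.S.mate_mate, swap_apply_def, h5.symm]

/-- This dictates the choice of `z`: the arcs from `D.z a` and from `D.e a` both run towards the
partner, so exchanging their continuations respects directions. -/
theorem sgn_z (a : Fin m × Bool) : D.sgn (.inl a) (.inl (partner a)) (.inr (D.z a)) = -1 := by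
  obtain ⟨i, β⟩ := a
  rcases Int.units_eq_one_or (D.ε i) with h | h <;> cases β <;>
    simp [sgn, z, h, boolSign, dirSign, dir, partner]

theorem sgn_swap {a b c : (Fin m × Bool) ⊕ Bool} (h1 : b ≠ a) (h2 : c ≠ a) (h3 : b ≠ c) :
    D.sgn a c b = - D.sgn a b c := by
  rcases a with a | α
  · rcases b with b | β <;> rcases c with c | γ
    · exact D.S.sgn_swap (by simpa using h1) (by simpa using h2) (by simpa using h3)
    · have : (some b : Option (Fin m × Bool)) ≠ some a := by simpa using h1
      simp only [sgn, ofExt]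
      rw [dirSign_swap this.symm]; simp
    · have : (some c : Option (Fin m × Bool)) ≠ some a := by simpa using h2
      simp only [sgn, ofExt]
      rw [dirSign_swap this.symm]; simp
    · have : γ = !β := by revert h3; cases γ <;> cases β <;> simp
      subst this
      simp [sgn, ofExt, boolSign_not]
  · simp only [sgn]
    rw [dirSign_swap (ofExt_ne h1 h2 h3)]; simp

theorem sgn_preMate {a b : Fin m × Bool} {c : (Fin m × Bool) ⊕ Bool} (hab : a ≠ b) (ha : c ≠ .inl a)
    (hb : c ≠ .inl b) :
    D.sgn (.inl a) (.inl b) (D.preMate a b c) = - D.sgn (.inl a) (.inl b) c := by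
  rcases c with c | γ
  · exact D.S.sgn_mate hab (by simpa using ha) (by simpa using hb)
  · simp [preMate, sgn, boolSign_not]

theorem joinMate_of_ne {a : Fin m × Bool} {c : (Fin m × Bool) ⊕ Bool} (h1 : c ≠ .inl (D.e a))
    (h2 : c ≠ .inr (D.z a)) (h3 : c ≠ .inl (D.e (partner a))) (h4 : c ≠ .inr (D.z (partner a))) :
    D.joinMate a (partner a) c = D.preMate a (partner a) c := by
  rw [joinMate_eq, swap_apply_of_ne_of_ne h1 h2, swap_apply_of_ne_of_ne]
  · intro h
    apply h3
    rw [← D.preMate_preMate a (partner a) c, h, D.e_partner]; rfl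
  · intro h
    apply h4
    rw [← D.preMate_preMate a (partner a) c, h, z_partner]; rfl

theorem joinMate_e (a : Fin m × Bool) :
    D.joinMate a (partner a) (.inl (D.e a)) = .inr (D.z (partner a)) := by
  rw [joinMate_eq, swap_apply_left, preMate, z_partner, swap_apply_of_ne_of_ne] <;> simp

theorem joinMate_z (a : Fin m × Bool) :
    D.joinMate a (partner a) (.inr (D.z a)) = .inl (D.e (partner a)) := by
  rw [joinMate_eq, swap_apply_right, preMate, e_partner, swap_apply_of_ne_of_ne]
  · simpa using D.S.mate_ne_self (partner_ne a).symm (D.e_ne a) (D.e_ne_partner a)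
  · simp

theorem joinMate_comm (a : Fin m × Bool) :
    D.joinMate (partner a) a = D.joinMate a (partner a) := by
  have := D.mate_comm (.inl a) (.inl (partner a))
  funext c
  simpa [mate, partner_partner] using (congrFun this c).symm

theorem joinMate_e_partner (a : Fin m × Bool) :
    D.joinMate a (partner a) (.inl (D.e (partner a))) = .inr (D.z a) := by
  have := D.joinMate_e (partner a)
  rwa [partner_partner, joinMate_comm] at this

theorem joinMate_z_partner (a : Fin m × Bool) :
    D.joinMate a (partner a) (.inr (D.z (partner a))) = .inl (D.e a) := by
  have := D.joinMate_z (partner a)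
  rwa [partner_partner, joinMate_comm] at this

theorem joinMate_cases (a : Fin m × Bool) {P : (Fin m × Bool) ⊕ Bool → Prop}
    (c : (Fin m × Bool) ⊕ Bool) (h1 : P (.inl (D.e a))) (h2 : P (.inr (D.z a)))
    (h3 : P (.inl (D.e (partner a)))) (h4 : P (.inr (D.z (partner a))))
    (h : D.joinMate a (partner a) c = D.preMate a (partner a) c → P c) : P c := by
  by_cases k1 : c = .inl (D.e a)
  · rwa [k1]
  by_cases k2 : c = .inr (D.z a)
  · rwa [k2]
  by_cases k3 : c = .inl (D.e (partner a))
  · rwa [k3]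
  by_cases k4 : c = .inr (D.z (partner a))
  · rwa [k4]
  exact h (D.joinMate_of_ne k1 k2 k3 k4)

theorem sgn_e_partner (a : Fin m × Bool) : D.S.sgn a (partner a) (D.e (partner a)) = 1 := by
  rw [D.e_partner, D.S.sgn_mate (partner_ne a).symm (D.e_ne a) (D.e_ne_partner a), D.sgn_e]; simp

theorem sgn_z_partner (a : Fin m × Bool) :
    D.sgn (.inl a) (.inl (partner a)) (.inr (D.z (partner a))) = 1 := by
  have := D.sgn_preMate (partner_ne a).symm (c := .inr (D.z a)) (by simp) (by simp)
  rw [sgn_z] at this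
  rw [z_partner]; simpa [preMate] using this

/-- At the partner, `e a` and `z a` are the sources of incoming arcs, while `e (partner a)` and `z
(partner a)` are the targets of outgoing ones. Re-pairing the four still matches incoming with
outgoing. -/
theorem sgn_joinMate {a : Fin m × Bool} (c : (Fin m × Bool) ⊕ Bool) (ha : c ≠ .inl a)
    (hb : c ≠ .inl (partner a)) :
    D.sgn (.inl a) (.inl (partner a)) (D.joinMate a (partner a) c) =
      - D.sgn (.inl a) (.inl (partner a)) c := by
  have h1 : D.sgn (.inl a) (.inl (partner a)) (.inl (D.e a)) = -1 := D.sgn_e a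
  have h2 : D.sgn (.inl a) (.inl (partner a)) (.inl (D.e (partner a))) = 1 := D.sgn_e_partner a
  revert ha hb
  refine D.joinMate_cases a (P := fun c => c ≠ .inl a → c ≠ .inl (partner a) →
    D.sgn (.inl a) (.inl (partner a)) (D.joinMate a (partner a) c) =
      - D.sgn (.inl a) (.inl (partner a)) c) c ?_ ?_ ?_ ?_ ?_
  · intro _ _; rw [joinMate_e, h1, sgn_z_partner, neg_neg]
  · intro _ _; rw [joinMate_z, h2, sgn_z, neg_neg]
  · intro _ _; rw [joinMate_e_partner, h2, sgn_z]
  · intro _ _; rw [joinMate_z_partner, h1, sgn_z_partner]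
  · intro h h1 h2
    rw [h, D.sgn_preMate (partner_ne a).symm h1 h2]

theorem joinMate_ne {a : Fin m × Bool} (c : (Fin m × Bool) ⊕ Bool) (ha : c ≠ .inl a)
    (hb : c ≠ .inl (partner a)) : D.joinMate a (partner a) c ≠ .inl a := by
  revert ha hb
  refine D.joinMate_cases a (P := fun c => c ≠ .inl a → c ≠ .inl (partner a) →
    D.joinMate a (partner a) c ≠ .inl a) c ?_ ?_ ?_ ?_ ?_
  · intro _ _; rw [joinMate_e]; simp
  · intro _ _; rw [joinMate_z]
    have := D.e_ne_partner (partner a)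
    rw [partner_partner] at this
    simpa using this
  · intro _ _; rw [joinMate_e_partner]; simp
  · intro _ _; rw [joinMate_z_partner]; simpa using D.e_ne a
  · intro h h1 h2
    rw [h]; exact D.preMate_ne (partner_ne a).symm h1 h2

theorem mate_ne {a b c : (Fin m × Bool) ⊕ Bool} (hab : a ≠ b) (ha : c ≠ a) (hb : c ≠ b) :
    D.mate a b c ≠ a := by
  rcases a with a | α <;> rcases b with b | β
  · have hab' : a ≠ b := by simpa using hab
    by_cases h : b = partner a
    · subst h; simpa [mate] using D.joinMate_ne c ha hb
    · simpa [mate, h] using D.preMate_ne hab' ha hb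
  · simp only [mate, newMate, if_neg hb]
    intro h
    have := congrArg ofExt h
    rw [ofExt_toExt] at this
    refine trailMate_ne (D.σ β) ?_ this
    have := ofExt_ne (β := β) hb (by simp : Sum.inl a ≠ Sum.inr β) ha
    exact this
  · simp only [mate, newMate, if_neg ha]
    exact toExt_ne _ _
  · rcases c with c | γ
    · simp [mate]
    · simpa [mate] using ha

theorem sgn_mate {a b c : (Fin m × Bool) ⊕ Bool} (hab : a ≠ b) (ha : c ≠ a) (hb : c ≠ b) :
    D.sgn a b (D.mate a b c) = - D.sgn a b c := by
  rcases a with a | α <;> rcases b with b | β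
  · have hab' : a ≠ b := by simpa using hab
    by_cases h : b = partner a
    · subst h; simpa [mate] using D.sgn_joinMate c ha hb
    · simpa [mate, h] using D.sgn_preMate hab' ha hb
  · have hne : ofExt c ≠ some a := ofExt_ne (β := β) hb (by simp : Sum.inl a ≠ Sum.inr β) ha
    simp only [mate, newMate, if_neg hb, sgn, ofExt_toExt]
    rw [dirSign_swap hne.symm, dirSign_swap (trailMate_ne _ hne).symm, dirSign_trailMate _ hne]
    simp
  · have hne : ofExt c ≠ some b := ofExt_ne (β := α) ha (by simp : Sum.inl b ≠ Sum.inr α) hb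
    simp only [mate, newMate, if_neg ha, sgn, ofExt_toExt]
    rw [ofExt, dirSign_trailMate _ hne]
    simp
  · rcases c with c | γ
    · simp only [mate, sgn, ofExt]
      have : dirSign none (some (partner c)) = - dirSign none (some c) := by
        obtain ⟨i, β⟩ := c; cases β <;> simp [dirSign, dir, partner]
      rw [this]; simp
    · exfalso; revert hab ha hb; cases α <;> cases β <;> cases γ <;> simp

end ExtensionData

end extension

/-! ### Adding two points: every new trail is a single cycle -/

namespace ExtensionData

variable {m : ℕ} [NeZero m] (D : ExtensionData m)

/-- The trail of a new point is its tournament trail, run forwards for `false` and backwards for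
`true`, with `none` read as the other new point. -/
theorem sameCycle_inr (β : Bool) {c b c' b' : (Fin m × Bool) ⊕ Bool} (hc : c ≠ .inr β)
    (hb : b ≠ .inr β) (hcb : c ≠ b) (h : D.sgn (.inr β) c b = 1) (hc' : c' ≠ .inr β)
    (hb' : b' ≠ .inr β) (hcb' : c' ≠ b') (h' : D.sgn (.inr β) c' b' = 1) :
    (turn (D.mate (.inr β)) (D.mate_mate (.inr β))).SameCycle (c, b) (c', b') := by
  have hne := ofExt_ne hc hb hcb
  have hne' := ofExt_ne hc' hb' hcb'
  have key : (turn (trailMate (D.σ β)) (trailMate_trailMate (D.σ β))).SameCycle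
      (ofExt c, ofExt b) (ofExt c', ofExt b') := by
    simp only [sgn] at h h'
    cases β
    · simp only [boolSign, Bool.false_eq_true, if_false, one_mul, dirSign_eq_one] at h h'
      exact sameCycle_turn_trailMate _ (D.trail_σ _) hne h hne' h'
    · simp only [boolSign, if_true, neg_mul, one_mul, neg_eq_iff_eq_neg, dirSign_eq_neg_one] at h h'
      refine sameCycle_turn_swap _ _ (sameCycle_turn_trailMate _ (D.trail_σ _) hne.symm ?_
        hne'.symm ?_ : (turn _ _).SameCycle (ofExt b, ofExt c) (ofExt b', ofExt c'))
      · rw [dir_swap hne.symm, h]; rfl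
      · rw [dir_swap hne'.symm, h']; rfl
  have := SameCycle.map_of_semiconj (g := turn (D.mate (.inr β)) (D.mate_mate (.inr β)))
    (fun p => (toExt β p.1, toExt β p.2)) (fun p => ?_) key
  · simpa only [toExt_ofExt hc, toExt_ofExt hb, toExt_ofExt hc', toExt_ofExt hb'] using this
  · obtain ⟨u, w⟩ := p
    rw [turn_apply, turn_apply]
    rcases w with _ | w
    · rcases u with _ | u
      · simp [toExt, mate, trailMate_self]
      · rw [trailMate_none_some _ (D.σ_none β)]
        simp [toExt, mate, partner]
    · have : toExt β u ≠ .inr β := toExt_ne β u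
      change (_, D.newMate β w (toExt β u)) = _
      rw [newMate, if_neg this, ofExt_toExt]

/-- The transitions in the trail of `a` before the old and the new arcs are joined. -/
def splitMate (a : Fin m × Bool) : (Fin m × Bool) ⊕ Bool → (Fin m × Bool) ⊕ Bool →
    (Fin m × Bool) ⊕ Bool
  | .inl b, c => D.preMate a b c
  | .inr β, c => D.newMate β a c

theorem splitMate_splitMate (a : Fin m × Bool) (b c : (Fin m × Bool) ⊕ Bool) :
    D.splitMate a b (D.splitMate a b c) = c := by
  rcases b with b | β
  · exact D.preMate_preMate _ _ _
  · exact D.newMate_newMate _ _ _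

theorem splitMate_of_ne {a : Fin m × Bool} {b : (Fin m × Bool) ⊕ Bool} (hb : b ≠ .inl (partner a))
    (c : (Fin m × Bool) ⊕ Bool) : D.mate (.inl a) b c = D.splitMate a b c := by
  rcases b with b | β
  · have : b ≠ partner a := by simpa using hb
    simp [mate, splitMate, this]
  · rfl

/-- The permutation of the arcs that belongs to `splitMate`. -/
def splitTurn (a : Fin m × Bool) :
    Perm (((Fin m × Bool) ⊕ Bool) × ((Fin m × Bool) ⊕ Bool)) :=
  turn (D.splitMate a) (D.splitMate_splitMate a)

/-- The arc `c → b` belongs to the trail of `a` and not to its reverse. -/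
def IsArc (a : Fin m × Bool) (p : ((Fin m × Bool) ⊕ Bool) × ((Fin m × Bool) ⊕ Bool)) : Prop :=
  p.1 ≠ .inl a ∧ p.2 ≠ .inl a ∧ p.1 ≠ p.2 ∧ D.sgn (.inl a) p.1 p.2 = 1

theorem isArc_splitTurn {a : Fin m × Bool} {p : ((Fin m × Bool) ⊕ Bool) × ((Fin m × Bool) ⊕ Bool)}
    (h : D.IsArc a p) : D.IsArc a (D.splitTurn a p) := by
  obtain ⟨c, b⟩ := p
  obtain ⟨h1, h2, h3, h4⟩ := h
  simp only at h1 h2 h3 h4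
  change D.IsArc a (b, D.splitMate a b c)
  have e : D.sgn (.inl a) b c = -1 := by
    rw [D.sgn_swap h1 h2 h3, h4]
  rcases b with b | β
  · have hab : a ≠ b := fun e => h2 (e ▸ rfl)
    refine ⟨h2, D.preMate_ne hab h1 h3, ?_, ?_⟩
    · intro h
      have := D.preMate_ne hab.symm h3 h1
      rw [preMate_comm] at this
      exact this h.symm
    · change D.sgn _ _ (D.preMate a b c) = 1
      rw [D.sgn_preMate hab h1 h3, e, neg_neg]
  · have hm := D.splitMate_of_ne (a := a) (b := .inr β) (by simp) c
    refine ⟨h2, ?_, ?_, ?_⟩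
    · rw [← hm]; exact D.mate_ne (by simp) h1 h3
    · rw [← hm, mate_comm]; exact (D.mate_ne (by simp) h3 h1).symm
    · change D.sgn (.inl a) (.inr β) (D.splitMate a (.inr β) c) = 1
      rw [← hm, D.sgn_mate (by simp) h1 h3, e, neg_neg]

theorem isArc_of_sameCycle {a : Fin m × Bool}
    {p q : ((Fin m × Bool) ⊕ Bool) × ((Fin m × Bool) ⊕ Bool)} (h : D.IsArc a p)
    (hpq : (D.splitTurn a).SameCycle p q) : D.IsArc a q :=
  sameCycle_induction (D.isArc_splitTurn h) (fun _ _ _ => D.isArc_splitTurn) hpq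

theorem sameCycle_old {a c b c' b' : Fin m × Bool} (h : D.IsArc a (.inl c, .inl b))
    (h' : D.IsArc a (.inl c', .inl b')) :
    (D.splitTurn a).SameCycle (.inl c, .inl b) (.inl c', .inl b') := by
  obtain ⟨h1, h2, h3, h4⟩ := h
  obtain ⟨h5, h6, h7, h8⟩ := h'
  refine SameCycle.map_of_semiconj
    (fun p : (Fin m × Bool) × (Fin m × Bool) => (Sum.inl p.1, Sum.inl p.2)) (fun p => rfl)
    (D.S.sameCycle (a := a) ?_ ?_ ?_ h4 ?_ ?_ ?_ h8)
  all_goals simp_all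

/-- Before the joining, old and new arcs lie in different cycles, as needed for merging them. -/
theorem exists_inl_of_sameCycle {a c b : Fin m × Bool}
    {q : ((Fin m × Bool) ⊕ Bool) × ((Fin m × Bool) ⊕ Bool)}
    (h : (D.splitTurn a).SameCycle (.inl c, .inl b) q) : ∃ c' b', q = (.inl c', .inl b') := by
  refine sameCycle_induction (P := fun q => ∃ c' b', q = (.inl c', .inl b')) ?_ ?_ h
  · exact ⟨_, _, rfl⟩
  · rintro _ - - ⟨c', b', rfl⟩
    exact ⟨_, _, rfl⟩

/-- The new arcs alternate between the two new points: two steps through an old point, or one step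
along the arc between the new points themselves (the case `none`). -/
theorem sameCycle_new_aux (a : Fin m × Bool) (β : Bool) (k : Fin m) :
    (D.splitTurn a).SameCycle (.inr β, toExt β (nbr (some a) β k))
      (.inr (!β), toExt (!β) (trailMate (D.σ (!β)) (some a) (nbr (some a) β k))) := by
  have hne : nbr (some a) β k ≠ some a := nbr_ne _ _ _
  rcases hu : nbr (some a) β k with _ | b
  · refine ⟨1, ?_⟩
    rw [zpow_one]
    change (_, D.newMate (!β) a (.inr β)) = _
    rw [newMate, if_neg (by simp)]
    rfl
  · refine ⟨2, ?_⟩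
    rw [zpow_ofNat, pow_two, mul_apply]
    change (_, D.newMate (!β) a (.inl b)) = _
    rw [newMate, if_neg (by simp)]
    rfl

theorem sameCycle_false_true (a : Fin m × Bool) (k : Fin m) :
    (D.splitTurn a).SameCycle (.inr false, toExt false (nbr (some a) false k))
      (.inr true, toExt true (nbr (some a) true (D.σ true (some a) k))) := by
  simpa [trailMate_nbr] using D.sameCycle_new_aux a false k

theorem sameCycle_true_false (a : Fin m × Bool) (k : Fin m) :
    (D.splitTurn a).SameCycle (.inr true, toExt true (nbr (some a) true k))
      (.inr false, toExt false (nbr (some a) false ((D.σ false (some a)).symm k))) := by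
  simpa [trailMate_nbr] using D.sameCycle_new_aux a true k

/-- The return map to the point `false` acts on positions as the quotient of the two transition
permutations at `a`, which is cyclic by `cycle_σ`. -/
theorem sameCycle_false_false (a : Fin m × Bool) (k l : Fin m) :
    (D.splitTurn a).SameCycle (.inr false, toExt false (nbr (some a) false k))
      (.inr false, toExt false (nbr (some a) false l)) := by
  have h := D.cycle_σ a k l
  refine sameCycle_induction (P := fun l => (D.splitTurn a).SameCycle
    (.inr false, toExt false (nbr (some a) false k))
      (.inr false, toExt false (nbr (some a) false l))) ?_ ?_ h
  · exact (D.sameCycle_false_true a k).trans (D.sameCycle_true_false a _)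
  · intro l _ _ hl
    exact (hl.trans (D.sameCycle_false_true a l)).trans (D.sameCycle_true_false a _)

/-- The new arcs, in the direction they have for `ε = 1`, are in one cycle. -/
theorem sameCycle_new_of_dir (a : Fin m × Bool) (k : Fin m)
    {c b : (Fin m × Bool) ⊕ Bool} (hc : c ≠ .inl a) (hb : b ≠ .inl a) (hcb : c ≠ b)
    (hnew : ¬ (c.isLeft ∧ b.isLeft)) (h : D.ε a.1 * D.sgn (.inl a) c b = 1) :
    (D.splitTurn a).SameCycle (.inr false, toExt false (nbr (some a) false k)) (c, b) := by
  have hε : ∀ x y : ℤˣ, D.ε a.1 * (D.ε a.1 * x * y) = x * y := fun x y => by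
    rw [← mul_assoc, ← mul_assoc, Int.units_mul_self, one_mul]
  have key : ∀ (β : Bool) (v : (Fin m × Bool) ⊕ Bool), v ≠ .inl a → v ≠ .inr β →
      boolSign β * dirSign (ofExt v) (some a) = 1 →
      (D.splitTurn a).SameCycle (.inr false, toExt false (nbr (some a) false k)) (.inr β, v) := by
    intro β v hva hvβ hd
    have hne : ofExt v ≠ some a := ofExt_ne (β := β) hvβ (by simp : Sum.inl a ≠ Sum.inr β) hva
    have hdir : dir (some a) (ofExt v) = β := by
      rw [dir_swap hne.symm]
      cases β
      · have : dirSign (ofExt v) (some a) = 1 := by simpa [boolSign] using hd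
        rw [dirSign_eq_one.1 this]; rfl
      · have : dirSign (ofExt v) (some a) = -1 := by
          simpa [boolSign, neg_eq_iff_eq_neg] using hd
        rw [dirSign_eq_neg_one.1 this]; rfl
    have hn := nbr_dir_pos hne
    rw [hdir] at hn
    have hv : v = toExt β (nbr (some a) β (pos (some a) (ofExt v))) := by
      rw [hn, toExt_ofExt hvβ]
    rw [hv]
    cases β
    · exact D.sameCycle_false_false a _ _
    · refine SameCycle.trans (D.sameCycle_false_false a _
        ((D.σ false (some a)).symm (pos (some a) (ofExt v)))) (D.sameCycle_true_false a _).symm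
  rcases c with c | γ
  · rcases b with b | β
    · simp at hnew
    · have hca : (some c : Option (Fin m × Bool)) ≠ some a := by simpa using hc
      have h1 : (D.splitTurn a).SameCycle (.inr !β, .inl c) (.inl c, .inr β) := by
        refine ⟨1, ?_⟩
        rw [zpow_one]
        change (Sum.inl c, D.preMate a c (.inr !β)) = _
        simp [preMate]
      refine (key _ _ hc (by simp) ?_).trans h1
      simp only [sgn, hε] at h
      change boolSign _ * dirSign (some c) (some a) = 1
      rw [boolSign_not, dirSign_swap hca.symm, neg_mul_neg, h]
  · refine key _ _ hb hcb.symm ?_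
    simpa only [sgn, hε] using h

theorem sameCycle_new {a : Fin m × Bool} {p q : ((Fin m × Bool) ⊕ Bool) × ((Fin m × Bool) ⊕ Bool)}
    (hp : D.IsArc a p) (hq : D.IsArc a q) (hp' : ¬ (p.1.isLeft ∧ p.2.isLeft))
    (hq' : ¬ (q.1.isLeft ∧ q.2.isLeft)) : (D.splitTurn a).SameCycle p q := by
  rcases Int.units_eq_one_or (D.ε a.1) with hε | hε
  · have key : ∀ {p : ((Fin m × Bool) ⊕ Bool) × ((Fin m × Bool) ⊕ Bool)}, D.IsArc a p →
        ¬ (p.1.isLeft ∧ p.2.isLeft) → (D.splitTurn a).SameCycle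
          (.inr false, toExt false (nbr (some a) false 0)) p := fun h h' =>
      D.sameCycle_new_of_dir a 0 h.1 h.2.1 h.2.2.1 h' (by rw [hε, h.2.2.2, mul_one])
    exact (key hp hp').symm.trans (key hq hq')
  -- For `ε = -1` the same closed trail is traversed backwards.
  · have key : ∀ {p : ((Fin m × Bool) ⊕ Bool) × ((Fin m × Bool) ⊕ Bool)}, D.IsArc a p →
        ¬ (p.1.isLeft ∧ p.2.isLeft) → (D.splitTurn a).SameCycle
          (.inr false, toExt false (nbr (some a) false 0)) p.swap := fun {p} h h' =>
      D.sameCycle_new_of_dir a 0 h.2.1 h.1 h.2.2.1.symm (fun h => h' h.symm) (by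
        rw [hε, D.sgn_swap h.1 h.2.1 h.2.2.1, h.2.2.2]; rfl)
    exact sameCycle_turn_swap _ _ ((key hp hp').symm.trans (key hq hq'))

/-- Joining exchanges the continuations of the old arc `e a → partner a` and the new arc `z a →
partner a`, which merges the old and the new cycle. -/
theorem sameCycle_inl (a : Fin m × Bool) {p q : ((Fin m × Bool) ⊕ Bool) × ((Fin m × Bool) ⊕ Bool)}
    (hp : D.IsArc a p) (hq : D.IsArc a q) :
    (turn (D.mate (.inl a)) (D.mate_mate (.inl a))).SameCycle p q := by
  have h0 : D.IsArc a (.inl (D.e a), .inl (partner a)) := by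
    refine ⟨by simpa using D.e_ne a, by simpa using partner_ne a, by simpa using D.e_ne_partner a, ?_⟩
    change D.S.sgn a (D.e a) (partner a) = 1
    rw [D.S.sgn_swap (partner_ne a) (D.e_ne a) (D.e_ne_partner a).symm, D.sgn_e, neg_neg]
  have h1 : D.IsArc a (.inr (D.z a), .inl (partner a)) := by
    refine ⟨by simp, by simpa using partner_ne a, by simp, ?_⟩
    rw [D.sgn_swap (by simpa using partner_ne a) (by simp) (by simp), D.sgn_z, neg_neg]
  have hmate : ∀ c, D.mate (.inl a) (.inl (partner a)) c = D.joinMate a (partner a) c := fun c => by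
    simp [mate]
  have key : ∀ {r : ((Fin m × Bool) ⊕ Bool) × ((Fin m × Bool) ⊕ Bool)}, D.IsArc a r →
      (turn (D.mate (.inl a)) (D.mate_mate (.inl a))).SameCycle
        (.inl (D.e a), .inl (partner a)) r := by
    intro r hr
    refine sameCycle_merge (f := D.splitTurn a) (q := (.inr (D.z a), .inl (partner a))) ?_ ?_ ?_ ?_ ?_
    · intro h
      obtain ⟨c, b, h⟩ := D.exists_inl_of_sameCycle h
      simp at h
    · rw [turn_apply, hmate, joinMate_e, z_partner]
      rfl
    · rw [turn_apply, hmate, joinMate_z, e_partner]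
      rfl
    · intro z hz hz1 hz2
      have harc : D.IsArc a z := hz.elim (D.isArc_of_sameCycle h0) (D.isArc_of_sameCycle h1)
      obtain ⟨c, b⟩ := z
      change (b, D.mate (.inl a) b c) = (b, D.splitMate a b c)
      by_cases hb : b = .inl (partner a)
      · subst hb
        -- The other two transitions changed by the joining concern arcs of the reversed trail; the
        -- sign rules them out.
        have hs : D.sgn (.inl a) (.inl (partner a)) c ≠ 1 := by
          rw [D.sgn_swap harc.1 harc.2.1 harc.2.2.1, harc.2.2.2]
          decide
        rw [hmate, D.joinMate_of_ne]
        · rfl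
        · rintro rfl; exact hz1 rfl
        · rintro rfl; exact hz2 rfl
        · rintro rfl; exact hs (D.sgn_e_partner a)
        · rintro rfl; exact hs (D.sgn_z_partner a)
      · rw [D.splitMate_of_ne hb]
    · by_cases hnew : r.1.isLeft ∧ r.2.isLeft
      · left
        obtain ⟨c | c, b | b⟩ := r
        · exact D.sameCycle_old h0 hr
        all_goals simp at hnew
      · right
        exact D.sameCycle_new h1 hr (by simp) hnew
  exact (key hp).symm.trans (key hq)

/-- The extension of a trail system by two points. -/
def extension : TrailSystem ((Fin m × Bool) ⊕ Bool) where
  mate := D.mate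
  sgn := D.sgn
  mate_mate := D.mate_mate
  mate_comm := D.mate_comm
  mate_ne := D.mate_ne
  sgn_swap := D.sgn_swap
  sgn_mate := D.sgn_mate
  sameCycle {a c b c' b'} h1 h2 h3 h4 h5 h6 h7 h8 := by
    rcases a with a | β
    · exact D.sameCycle_inl a ⟨h1, h2, h3, h4⟩ ⟨h5, h6, h7, h8⟩
    · exact D.sameCycle_inr β h1 h2 h3 h4 h5 h6 h7 h8

theorem isOriented_extension (h : D.ε = 1) : D.extension.IsOriented := by
  intro a b c hab hbc hac
  have h' : ∀ i, D.ε i = 1 := fun i => by rw [h]; rfl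
  change D.sgn a b c = D.sgn b c a
  rcases a with a | α <;> rcases b with b | β <;> rcases c with c | γ
  · exact D.oriented a b c (by simpa using hab) (by simpa using hbc) (by simpa using hac)
  · simp [sgn, ofExt, h']
  · simp [sgn, ofExt, h']
  · have : γ = !β := by revert hbc; cases γ <;> cases β <;> simp
    subst this
    simp only [sgn, ofExt, h', one_mul]
  · simp [sgn, ofExt, h']
  · have : γ = !α := by revert hac; cases γ <;> cases α <;> simp
    subst this
    have : (none : Option (Fin m × Bool)) ≠ some b := by simp
    simp only [sgn, ofExt, h', one_mul]
    rw [dirSign_swap this, boolSign_not]; simp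
  · have : β = !α := by revert hab; cases β <;> cases α <;> simp
    subst this
    have : (none : Option (Fin m × Bool)) ≠ some c := by simp
    simp only [sgn, ofExt]
    rw [dirSign_swap this, boolSign_not]; simp
  · exfalso; revert hab hbc hac; cases α <;> cases β <;> cases γ <;> simp

/-- The oriented old triples force equal values of `t` at `(i, false)` and `(j, false)`. Comparing
both with a new point forces these values to differ by the factor `D.ε i * D.ε j`. -/
theorem not_isOrientable_extension {i j : Fin m} (h : D.ε i ≠ D.ε j) :
    ¬ D.extension.IsOrientable := by
  rintro ⟨t, ht⟩
  have hij : i ≠ j := fun e => h (e ▸ rfl)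
  have h1 : t (.inl (i, false)) * D.S.sgn (i, false) (j, false) (i, true) =
      t (.inl (j, false)) * D.S.sgn (j, false) (i, true) (i, false) :=
    ht (.inl (i, false)) (.inl (j, false)) (.inl (i, true)) (by simp [hij]) (by simp) (by simp)
  rw [D.oriented (i, false) (j, false) (i, true) (by simp [hij]) (by simp) (by simp)] at h1
  have h1 := mul_right_cancel h1
  have h2 : t (.inr false) * (boolSign false * dirSign (some (i, false)) (some (j, false))) =
      t (.inl (i, false)) * (D.ε i * boolSign false * dirSign (some (i, false)) (some (j, false))) :=
    ht (.inr false) (.inl (i, false)) (.inl (j, false)) (by simp) (by simp [hij]) (by simp)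
  have h3 : t (.inr false) * (boolSign false * dirSign (some (j, false)) (some (i, false))) =
      t (.inl (j, false)) * (D.ε j * boolSign false * dirSign (some (j, false)) (some (i, false))) :=
    ht (.inr false) (.inl (j, false)) (.inl (i, false)) (by simp) (by simp [hij.symm]) (by simp)
  rw [mul_assoc (D.ε i), ← mul_assoc (t _) (D.ε i)] at h2
  rw [mul_assoc (D.ε j), ← mul_assoc (t _) (D.ε j)] at h3
  have h2 := mul_right_cancel h2
  have h3 := mul_right_cancel h3
  rw [h2, h1] at h3
  exact h (mul_left_cancel h3)

end ExtensionData

/-! ### Existence of trail systems by induction -/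

theorem TrailSystem.exists_extensionData {m : ℕ} [NeZero m] (hm : 2 ≤ m)
    (S : TrailSystem (Fin m × Bool)) (hS : S.IsOriented) (ε : Fin m → ℤˣ) :
    ∃ D : ExtensionData m, D.ε = ε := by
  obtain ⟨σ, τ, h1, h2, h3, h4, h5⟩ := exists_trails hm
  have : ∀ i : Fin m, ∃ c, c ≠ (i, false) ∧ c ≠ (i, true) ∧
      S.sgn (i, false) (i, true) c = -1 := by
    intro i
    have : Nontrivial (Fin m) := Fin.nontrivial_iff_two_le.2 hm
    obtain ⟨j, hj⟩ := exists_ne i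
    have n1 : (j, false) ≠ (i, false) := by simp [hj]
    have n2 : (j, false) ≠ (i, true) := by simp
    have n3 : (i, false) ≠ (i, true) := by simp
    rcases Int.units_eq_one_or (S.sgn (i, false) (i, true) (j, false)) with h | h
    -- An arc with the wrong direction is replaced by the other arc of the same passage.
    · exact ⟨S.mate (i, false) (i, true) (j, false), S.mate_ne n3 n1 n2,
        S.mate_ne_right n3 n1 n2, by rw [S.sgn_mate n3 n1 n2, h]⟩
    · exact ⟨_, n1, n2, h⟩
  choose e he1 he2 he3 using this
  refine ⟨{
    S := S
    oriented := hS
    σ := fun β => if β then τ else σ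
    σ_none := by simp [h1, h2]
    trail_σ := by simp [h3, h4]
    cycle_σ := by simpa using h5
    e := fun a => if a.2 then S.mate (a.1, false) (a.1, true) (e a.1) else e a.1
    e_ne := ?_
    e_ne_partner := ?_
    e_partner := ?_
    sgn_e := ?_
    ε := ε }, rfl⟩
  · rintro ⟨i, _ | _⟩
    · exact he1 i
    · exact S.mate_ne_right (by simp) (he1 i) (he2 i)
  · rintro ⟨i, _ | _⟩
    · exact he2 i
    · exact S.mate_ne (by simp) (he1 i) (he2 i)
  · rintro ⟨i, _ | _⟩
    · rfl
    · simp [partner, S.mate_comm (i, true) (i, false), S.mate_mate]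
  · rintro ⟨i, _ | _⟩
    · exact he3 i
    · have n1 := S.mate_ne (by simp : (i, false) ≠ (i, true)) (he1 i) (he2 i)
      have n2 := S.mate_ne_right (by simp : (i, false) ≠ (i, true)) (he1 i) (he2 i)
      have n3 := S.sgn_mate (by simp : (i, false) ≠ (i, true)) (he1 i) (he2 i)
      rw [he3] at n3
      change S.sgn (i, true) (i, false) (S.mate (i, false) (i, true) (e i)) = -1
      -- Seen from the other partner the direction flips, by cyclic invariance; passing to the mate
      -- flips it back.
      rw [hS _ _ _ (by simp) n1.symm n2.symm, S.sgn_swap (by simp) n1 n2.symm, n3]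
      rfl

/-- The two new points form a new pair. -/
noncomputable def pairEquiv (m : ℕ) : Fin (m + 1) × Bool ≃ (Fin m × Bool) ⊕ Bool :=
  Fintype.equivOfCardEq (by simp; ring)

theorem exists_isOriented (m : ℕ) (hm : 2 ≤ m) : ∃ S : TrailSystem (Fin m × Bool), S.IsOriented := by
  induction m, hm using Nat.le_induction with
  | base =>
    have e : Fin 2 × Bool ≃ Fin 4 := Fintype.equivOfCardEq (by simp)
    exact ⟨_, tetrahedron_isOriented.map e⟩
  | succ m hm ih =>
    obtain ⟨S, hS⟩ := ih
    have : NeZero m := ⟨by omega⟩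
    obtain ⟨D, hD⟩ := S.exists_extensionData hm hS 1
    exact ⟨_, (D.isOriented_extension hD).map (pairEquiv m)⟩

theorem exists_trailSystem_isOriented {n : ℕ} (hn : 4 ≤ n) (he : Even n) :
    ∃ S : TrailSystem (Fin n), S.IsOriented := by
  obtain ⟨m, rfl⟩ := he
  obtain ⟨S, hS⟩ := exists_isOriented m (by omega)
  have e : Fin (m + m) ≃ Fin m × Bool := Fintype.equivOfCardEq (by simp; ring)
  exact ⟨_, hS.map e⟩

/-- A non-constant `ε` needs two old pairs, hence at least six points after the extension. -/
theorem exists_trailSystem_not_isOrientable {n : ℕ} (hn : 6 ≤ n) (he : Even n) :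
    ∃ S : TrailSystem (Fin n), ¬ S.IsOrientable := by
  obtain ⟨m, rfl⟩ : ∃ m, n = m + m + 2 := by
    obtain ⟨m, rfl⟩ := he
    exact ⟨m - 1, by omega⟩
  have hm : 2 ≤ m := by omega
  obtain ⟨S, hS⟩ := exists_isOriented m hm
  have : NeZero m := ⟨by omega⟩
  obtain ⟨D, hD⟩ := S.exists_extensionData hm hS (Function.update 1 0 (-1))
  have e : Fin (m + m + 2) ≃ (Fin m × Bool) ⊕ Bool := Fintype.equivOfCardEq (by simp; ring)
  have h1 : (⟨1, by omega⟩ : Fin m) ≠ 0 := by simp [Fin.ext_iff]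
  refine ⟨D.extension.map e, fun h => D.not_isOrientable_extension (i := ⟨1, by omega⟩) (j := 0) ?_
    (TrailSystem.isOrientable_of_map h)⟩
  rw [hD, Function.update_of_ne h1]
  simp

end

/-! ### Counting faces of embedding schemes -/

namespace EmbeddingScheme

variable {V : Type*} {G : SimpleGraph V} (S : EmbeddingScheme G)

theorem dartSign_symm (d : G.Dart) : S.dartSign d.symm = S.dartSign d := by
  unfold dartSign
  congr 1
  exact Subtype.ext (by simp)

theorem reverse_reverse (x : Flag G) : S.reverse (S.reverse x) = x := by
  obtain ⟨d, k⟩ := x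
  simp [reverse, dartSign_symm, mul_assoc, Int.units_mul_self]

/-- Walking back along a facial walk undoes the walk; this makes `next` injective. -/
theorem next_reverse_next (x : Flag G) : S.next (S.reverse (S.next x)) = S.reverse x := by
  obtain ⟨⟨⟨u, v⟩, h⟩, k⟩ := x
  simp only [next, reverse]
  rw [dartSign_symm, neg_mul, mul_assoc, Int.units_mul_self, mul_one]
  refine Prod.ext ?_ rfl
  refine (SimpleGraph.Dart.ext_iff _ _).2 (Prod.ext rfl ?_)
  have key : ∀ (j : ℤˣ) (w : G.neighborSet v),
      (S.rot v ^ ((-j : ℤˣ) : ℤ)) ((S.rot v ^ (j : ℤ)) w) = w := fun j w => by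
    rw [← Equiv.Perm.mul_apply, ← zpow_add, Units.val_neg, neg_add_cancel, zpow_zero]
    rfl
  exact congrArg Subtype.val (key _ ⟨u, h.symm⟩)

theorem next_injective : Function.Injective S.next := fun x y h => by
  have := congrArg (fun z => S.next (S.reverse z)) h
  simp only [next_reverse_next] at this
  rw [← S.reverse_reverse x, this, reverse_reverse]

/-- The facial walk of a flag. -/
def face (x : Flag G) : S.FacialWalk := Quot.mk _ x

theorem face_next (x : Flag G) : S.face (S.next x) = S.face x :=
  (Quot.sound (r := fun x y => y = S.next x ∨ y = S.reverse x) (Or.inl rfl)).symm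

theorem face_reverse (x : Flag G) : S.face (S.reverse x) = S.face x :=
  (Quot.sound (r := fun x y => y = S.next x ∨ y = S.reverse x) (Or.inr rfl)).symm

theorem face_surjective : Function.Surjective S.face := Quot.mk_surjective

theorem fst_next (x : Flag G) : (S.next x).1.fst = x.1.snd := rfl

theorem snd_next_ne (hr : ∀ v w, S.rot v w ≠ w) (x : Flag G) : (S.next x).1.snd ≠ x.1.fst := by
  obtain ⟨⟨⟨u, v⟩, h⟩, k⟩ := x
  intro he
  have he' : (S.rot v ^ ((k * S.dartSign ⟨(u, v), h⟩ : ℤˣ) : ℤ)) ⟨u, h.symm⟩ =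
      (⟨u, h.symm⟩ : G.neighborSet v) := Subtype.ext he
  rcases Int.units_eq_one_or (k * S.dartSign ⟨(u, v), h⟩) with h1 | h1
  · rw [h1] at he'; exact hr _ _ (by simpa using he')
  · rw [h1] at he'
    have := congrArg (S.rot v) he'
    simp at this
    exact hr _ _ this.symm

variable [Finite V]

instance finite_facialWalk : Finite S.FacialWalk := by
  classical
  have := Fintype.ofFinite V
  unfold FacialWalk; infer_instance

theorem card_flag (G : SimpleGraph V) : Nat.card (Flag G) = 4 * Nat.card G.edgeSet := by
  classical
  have := Fintype.ofFinite V
  rw [Nat.card_prod, Nat.card_eq_fintype_card, G.dart_card_eq_twice_card_edges,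
    Nat.card_eq_fintype_card (α := ℤˣ), Nat.card_eq_fintype_card, SimpleGraph.card_edgeSet]
  simp; ring

/-- In a bipartite graph without vertices of degree one every face has length at least four. -/
theorem two_mul_card_facialWalk_le (side : V → Bool) (hs : ∀ v w, G.Adj v w → side v ≠ side w)
    (hr : ∀ v w, S.rot v w ≠ w) : 2 * Nat.card S.FacialWalk ≤ Nat.card G.edgeSet := by
  classical
  have := Fintype.ofFinite V
  have := Fintype.ofFinite S.FacialWalk
  -- Every edge carries four flags, and every face contains at least eight: four consecutive steps
  -- and their reverses.
  suffices h : 8 * Nat.card S.FacialWalk ≤ Nat.card (Flag G) by rw [card_flag] at h; omega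
  rw [Nat.card_eq_fintype_card, Nat.card_eq_fintype_card, mul_comm, ← smul_eq_mul,
    ← Finset.card_univ, ← Finset.card_univ]
  rw [Finset.card_eq_sum_card_fiberwise (f := S.face)
    (s := Finset.univ) (t := Finset.univ) (fun _ _ => Finset.mem_coe.2 (Finset.mem_univ _))]
  refine Finset.card_nsmul_le_sum _ _ _ fun q _ => ?_
  obtain ⟨x, rfl⟩ := S.face_surjective q
  have h1 := S.snd_next_ne hr x
  have h2 := S.snd_next_ne hr (S.next x)
  have h3 := S.snd_next_ne hr (S.next (S.next x))
  have s0 := hs _ _ x.1.adj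
  have s1 := hs _ _ (S.next x).1.adj
  have s2 := hs _ _ (S.next (S.next x)).1.adj
  have s3 := hs _ _ (S.next (S.next (S.next x))).1.adj
  have q0 := S.face_reverse x
  have q1 := S.face_reverse (S.next x)
  have q2 := S.face_reverse (S.next (S.next x))
  have q3 := S.face_reverse (S.next (S.next (S.next x)))
  have p1 := S.face_next x
  have p2 := S.face_next (S.next x)
  have p3 := S.face_next (S.next (S.next x))
  have f1 := S.fst_next x
  have f2 := S.fst_next (S.next x)
  have f3 := S.fst_next (S.next (S.next x))
  generalize S.next (S.next (S.next x)) = x3 at *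
  generalize S.next (S.next x) = x2 at *
  generalize S.next x = x1 at *
  -- Even the underlying darts differ: consecutive steps do not backtrack, and bipartiteness
  -- separates points three steps apart. The walk may return to its start after four steps.
  have hnd : ([x, x2, S.reverse x1, S.reverse x3, S.reverse x, S.reverse x2, x1, x3].map
      fun y : Flag G => (y.1.fst, y.1.snd)).Nodup := by
    simp only [reverse, List.map_cons, List.map_nil]
    simp only [SimpleGraph.Dart.symm, Prod.fst_swap, Prod.snd_swap]
    rw [f1] at s1 ⊢
    rw [f1] at h2
    rw [f2] at s2 h3 ⊢
    rw [f3] at s3 ⊢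
    generalize x.1.fst = u at *
    generalize x.1.snd = v at *
    generalize x1.1.snd = w at *
    generalize x2.1.snd = z at *
    generalize x3.1.snd = y at *
    have e1 : u ≠ v := by rintro rfl; exact s0 rfl
    have e2 : v ≠ w := by rintro rfl; exact s1 rfl
    have e3 : w ≠ z := by rintro rfl; exact s2 rfl
    have e4 : z ≠ y := by rintro rfl; exact s3 rfl
    have e5 : u ≠ z := by
      rintro rfl; revert s0 s1 s2; cases side u <;> cases side v <;> cases side w <;> simp
    have e6 : v ≠ y := by
      rintro rfl; revert s1 s2 s3; cases side v <;> cases side w <;> cases side z <;> simp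
    simp [h2, e1, e2, e3, e4, e5, e6, h1.symm, h2.symm, h3.symm, e1.symm, e2.symm,
      e3.symm, e4.symm, e5.symm, e6.symm]
  have hnd' := List.toFinset_card_of_nodup (List.Nodup.of_map _ hnd)
  refine (show 8 = _ from hnd'.symm).le.trans (Finset.card_le_card ?_)
  intro y hy
  rw [Finset.mem_filter]
  refine ⟨Finset.mem_univ _, ?_⟩
  simp only [List.mem_toFinset, List.mem_cons, List.not_mem_nil, or_false] at hy
  rcases hy with rfl | rfl | rfl | rfl | rfl | rfl | rfl | rfl <;> simp_all

/-- If all faces have length four, then there are at least half as many faces as edges. -/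
theorem card_edgeSet_le_of_next (h : ∀ x, S.next (S.next (S.next (S.next x))) = x) :
    Nat.card G.edgeSet ≤ 2 * Nat.card S.FacialWalk := by
  classical
  have := Fintype.ofFinite V
  have := Fintype.ofFinite S.FacialWalk
  suffices h : Nat.card (Flag G) ≤ 8 * Nat.card S.FacialWalk by rw [card_flag] at h; omega
  -- A set of at most eight flags, unchanged by `next` and `reverse`, which therefore contains the
  -- whole face of `x`.
  let cls (x : Flag G) : Finset (Flag G) :=
    [x, S.next x, S.next (S.next x), S.next (S.next (S.next x)), S.reverse x,
      S.reverse (S.next x), S.reverse (S.next (S.next x)),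
      S.reverse (S.next (S.next (S.next x)))].toFinset
  have cls_next : ∀ x, cls (S.next x) = cls x := by
    intro x
    ext y
    simp only [cls, h, List.mem_toFinset, List.mem_cons, List.not_mem_nil, or_false]
    tauto
  have cls_reverse : ∀ x, cls (S.reverse x) = cls x := by
    intro x
    have h1 := S.next_reverse_next (S.next (S.next (S.next x)))
    rw [h] at h1
    have h2 := S.next_reverse_next (S.next (S.next x))
    have h3 := S.next_reverse_next (S.next x)
    ext y
    simp only [cls, h1, h2, h3, reverse_reverse, List.mem_toFinset, List.mem_cons,
      List.not_mem_nil, or_false]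
    tauto
  have hcls : ∀ x y : Flag G, S.face x = S.face y → y ∈ cls x := by
    intro x y hxy
    have : cls x = cls y := by
      refine congrArg (Quot.lift (r := fun x y => y = S.next x ∨ y = S.reverse x) cls ?_) hxy
      rintro a b (rfl | rfl)
      · exact (cls_next a).symm
      · exact (cls_reverse a).symm
    rw [this]
    simp [cls]
  rw [Nat.card_eq_fintype_card, Nat.card_eq_fintype_card, mul_comm, ← smul_eq_mul,
    ← Finset.card_univ, ← Finset.card_univ]
  rw [Finset.card_eq_sum_card_fiberwise (f := S.face)
    (s := Finset.univ) (t := Finset.univ) (fun _ _ => Finset.mem_coe.2 (Finset.mem_univ _))]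
  refine Finset.sum_le_card_nsmul _ _ _ fun q _ => ?_
  obtain ⟨x, rfl⟩ := S.face_surjective q
  refine (Finset.card_le_card (t := cls x) ?_).trans (List.toFinset_card_le _)
  intro y hy
  exact hcls _ _ (Finset.mem_filter.1 hy).2.symm

end EmbeddingScheme

/-! ### The Levi graph of the complete 3-uniform hypergraph -/

namespace Hypergraph

variable {n : ℕ}

/-- The triple of three distinct points as an edge. -/
def triple {a b c : Fin n} (hab : a ≠ b) (hac : a ≠ c) (hbc : b ≠ c) :
    (completeThreeUniform n).edgeSet :=
  ⟨{a, b, c}, Set.ncard_eq_three.2 ⟨a, b, c, hab, hac, hbc, rfl⟩⟩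

theorem eq_insert_of_mem {e : (completeThreeUniform n).edgeSet} {a b c : Fin n} (hab : a ≠ b)
    (hac : a ≠ c) (hbc : b ≠ c) (ha : a ∈ e.1) (hb : b ∈ e.1) (hc : c ∈ e.1) : e.1 = {a, b, c} := by
  refine (Set.eq_of_subset_of_ncard_le ?_ ?_ (Set.toFinite _)).symm
  · rintro x (rfl | rfl | rfl) <;> assumption
  · have h : e.1.ncard = 3 := e.2
    rw [h, Set.ncard_eq_three.2 ⟨a, b, c, hab, hac, hbc, rfl⟩]

theorem exists_of_mem {e : (completeThreeUniform n).edgeSet} {a : Fin n} (ha : a ∈ e.1) :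
    ∃ b c, a ≠ b ∧ a ≠ c ∧ b ≠ c ∧ b ∈ e.1 ∧ c ∈ e.1 := by
  obtain ⟨x, y, z, hxy, hxz, hyz, he⟩ := Set.ncard_eq_three.1 e.2
  rw [he] at ha ⊢
  rcases ha with rfl | rfl | rfl
  · exact ⟨y, z, hxy, hxz, hyz, by simp, by simp⟩
  · exact ⟨x, z, hxy.symm, hyz, hxz, by simp, by simp⟩
  · exact ⟨x, y, hxz.symm, hyz.symm, hxy, by simp, by simp⟩

/-- The Levi graph of the complete 3-uniform hypergraph. -/
abbrev leviThree (n : ℕ) : SimpleGraph ((completeThreeUniform n).vertexSet ⊕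
    (completeThreeUniform n).edgeSet) := (completeThreeUniform n).leviGraph

/-- A point as a vertex of the Levi graph. -/
abbrev pt (a : Fin n) : (completeThreeUniform n).vertexSet ⊕ (completeThreeUniform n).edgeSet :=
  .inl ⟨a, Set.mem_univ a⟩

theorem pt_injective : Function.Injective (pt (n := n)) := fun _ _ h =>
  congrArg Subtype.val (Sum.inl_injective h)

theorem adj_pt {a : Fin n} {e : (completeThreeUniform n).edgeSet} (h : a ∈ e.1) :
    (leviThree n).Adj (pt a) (.inr e) := h

/-- An edge as a neighbour of one of its points. -/
def nbEdge {a : (completeThreeUniform n).vertexSet} (e : (completeThreeUniform n).edgeSet)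
    (h : a.1 ∈ e.1) : (leviThree n).neighborSet (.inl a) := ⟨.inr e, h⟩

/-- A point as a neighbour of an edge. -/
def nbPt {e : (completeThreeUniform n).edgeSet} (a : Fin n) (h : a ∈ e.1) :
    (leviThree n).neighborSet (.inr e) := ⟨pt a, h⟩

theorem exists_two_ne (hn : 4 ≤ n) (a b : Fin n) : ∃ c d, c ≠ a ∧ c ≠ b ∧ d ≠ a ∧ d ≠ b ∧ c ≠ d := by
  have h : 1 < ({a, b}ᶜ : Finset (Fin n)).card := by
    rw [Finset.card_compl, Fintype.card_fin]
    have := Finset.card_le_two (a := a) (b := b)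
    omega
  obtain ⟨c, hc, d, hd, hcd⟩ := Finset.one_lt_card.1 h
  simp only [Finset.mem_compl, Finset.mem_insert, Finset.mem_singleton, not_or] at hc hd
  exact ⟨c, d, hc.1, hc.2, hd.1, hd.2, hcd⟩

theorem leviThree_connected (hn : 4 ≤ n) : (leviThree n).Connected := by
  have hpt : ∀ a b : Fin n, (leviThree n).Reachable (pt a) (pt b) := by
    intro a b
    by_cases hab : a = b
    · rw [hab]
    · obtain ⟨c, -, hca, hcb, -⟩ := exists_two_ne hn a b
      let e := triple hab hca.symm hcb.symm
      have h1 : (leviThree n).Adj (pt a) (.inr e) := adj_pt (by simp [e, triple])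
      have h2 : (leviThree n).Adj (pt b) (.inr e) := adj_pt (by simp [e, triple])
      exact h1.reachable.trans h2.symm.reachable
  have hall : ∀ v, (leviThree n).Reachable (pt ⟨0, by omega⟩) v := by
    rintro (⟨a, ha⟩ | e)
    · exact hpt _ a
    · obtain ⟨x, y, z, -, -, -, he⟩ := Set.ncard_eq_three.1 e.2
      have : x ∈ e.1 := by rw [he]; simp
      exact (hpt _ x).trans (adj_pt this).reachable
  have : Nonempty ((completeThreeUniform n).vertexSet ⊕ (completeThreeUniform n).edgeSet) :=
    ⟨pt ⟨0, by omega⟩⟩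
  exact ⟨fun u v => (hall u).symm.trans (hall v)⟩

theorem neighborSet_nontrivial (hn : 4 ≤ n)
    (v : (completeThreeUniform n).vertexSet ⊕ (completeThreeUniform n).edgeSet) :
    Nontrivial ((leviThree n).neighborSet v) := by
  rcases v with ⟨a, ha⟩ | e
  · obtain ⟨b, -, hb, -⟩ := exists_two_ne hn a a
    obtain ⟨c, d, hca, hcb, hda, hdb, hcd⟩ := exists_two_ne hn a b
    have h1 : a ∈ (triple hb.symm hca.symm hcb.symm).1 := by simp [triple]
    have h2 : a ∈ (triple hb.symm hda.symm hdb.symm).1 := by simp [triple]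
    refine ⟨⟨nbEdge _ h1, nbEdge _ h2, ?_⟩⟩
    intro h
    have h1 : ({a, b, c} : Set (Fin n)) = {a, b, d} :=
      congrArg Subtype.val (Sum.inr_injective (congrArg Subtype.val h))
    have h2 : c ∈ ({a, b, d} : Set (Fin n)) := by rw [← h1]; simp
    simp [hca, hcb, hcd] at h2
  · obtain ⟨x, y, z, hxy, -, -, he⟩ := Set.ncard_eq_three.1 e.2
    have hx : x ∈ e.1 := by rw [he]; simp
    have hy : y ∈ e.1 := by rw [he]; simp
    refine ⟨⟨nbPt x hx, nbPt y hy, ?_⟩⟩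
    exact fun h => hxy (pt_injective (congrArg Subtype.val h))

theorem card_edgeSet : Nat.card (completeThreeUniform n).edgeSet = n.choose 3 := by
  classical
  have h : Fintype.card (Finset.powersetCard 3 (Finset.univ : Finset (Fin n))) = n.choose 3 := by
    simp
  rw [← h, ← Nat.card_eq_fintype_card]
  refine Nat.card_congr (Equiv.symm ?_)
  refine Equiv.ofBijective (fun s => ⟨(s.1 : Set (Fin n)), ?_⟩) ⟨?_, ?_⟩
  · change (s.1 : Set (Fin n)).ncard = 3
    rw [Set.ncard_coe_finset]
    exact (Finset.mem_powersetCard.1 s.2).2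
  · intro s t hst
    exact Subtype.ext (Finset.coe_injective (congrArg Subtype.val hst))
  · rintro ⟨e, he⟩
    have he' : e.ncard = 3 := he
    refine ⟨⟨e.toFinset, Finset.mem_powersetCard.2 ⟨Finset.subset_univ _, ?_⟩⟩, ?_⟩
    · rw [← Set.ncard_eq_toFinset_card', he']
    · exact Subtype.ext (by simp)

theorem card_vertex : Nat.card ((completeThreeUniform n).vertexSet ⊕
    (completeThreeUniform n).edgeSet) = n + n.choose 3 := by
  rw [Nat.card_sum, card_edgeSet]
  congr 1
  change Nat.card (Set.univ : Set (Fin n)) = n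
  simp

theorem card_leviThree_edgeSet : Nat.card (leviThree n).edgeSet = 3 * n.choose 3 := by
  classical
  have h : Nat.card (leviThree n).edgeSet =
      Nat.card (Σ e : (completeThreeUniform n).edgeSet, e.1) := by
    refine Nat.card_congr (Equiv.symm ?_)
    refine Equiv.ofBijective (fun p => ⟨s(pt p.2.1, .inr p.1), adj_pt p.2.2⟩) ⟨?_, ?_⟩
    · rintro ⟨e, a, ha⟩ ⟨f, b, hb⟩ h
      have h1 : s(pt a, .inr e) = s(pt b, .inr f) := congrArg Subtype.val h
      rw [Sym2.eq_iff] at h1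
      rcases h1 with ⟨h1, h2⟩ | ⟨h1, -⟩
      · obtain rfl : e = f := Sum.inr_injective h2
        obtain rfl : a = b := pt_injective h1
        rfl
      · simp at h1
    · rintro ⟨x, hx⟩
      induction x with
      | _ v w =>
        rw [SimpleGraph.mem_edgeSet] at hx
        rcases v with ⟨a, ha⟩ | e <;> rcases w with ⟨b, hb⟩ | f
        · exact hx.elim
        · exact ⟨⟨f, a, hx⟩, rfl⟩
        · exact ⟨⟨e, b, hx⟩, Subtype.ext Sym2.eq_swap⟩
        · exact hx.elim
  rw [h, Nat.card_sigma]
  have : ∀ e : (completeThreeUniform n).edgeSet, Nat.card e.1 = 3 := fun e => e.2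
  simp only [this]
  rw [Finset.sum_const, Finset.card_univ, ← Nat.card_eq_fintype_card, card_edgeSet, smul_eq_mul,
    mul_comm]

theorem numFaces_eq (hn : 4 ≤ n) (S : EmbeddingScheme (leviThree n)) :
    S.numFaces = Nat.card S.FacialWalk := by
  have : IsEmpty {v // (leviThree n).neighborSet v = ∅} := by
    refine ⟨fun ⟨v, hv⟩ => ?_⟩
    have := neighborSet_nontrivial hn v
    have h : ((leviThree n).neighborSet v).Nonempty := Set.nonempty_coe_sort.1 inferInstance
    exact h.ne_empty hv
  rw [EmbeddingScheme.numFaces, Nat.card_of_isEmpty (α := {v // (leviThree n).neighborSet v = ∅}),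
    add_zero]

/-- With `C = n.choose 3` there are `n + C` vertices, `3 * C` edges and at most half as many faces
as edges. -/
theorem two_mul_eulerChar_le (hn : 4 ≤ n) (S : EmbeddingScheme (leviThree n)) :
    2 * S.eulerChar ≤ 2 * n - n.choose 3 := by
  have h := S.two_mul_card_facialWalk_le Sum.isLeft
    (by rintro (v | e) (w | f) h <;> first | exact h.elim | simp)
    (fun v w => by
      have := neighborSet_nontrivial hn v
      exact (S.rot_isCycleOn v).apply_ne Set.nontrivial_univ (Set.mem_univ w))
  rw [EmbeddingScheme.eulerChar, numFaces_eq hn, card_vertex]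
  rw [card_leviThree_edgeSet] at h ⊢
  push_cast
  omega

theorem two_mul_eulerChar_eq (hn : 4 ≤ n) (S : EmbeddingScheme (leviThree n))
    (hS : ∀ x, S.next (S.next (S.next (S.next x))) = x) :
    2 * S.eulerChar = 2 * n - n.choose 3 := by
  refine le_antisymm (two_mul_eulerChar_le hn S) ?_
  have h := S.card_edgeSet_le_of_next hS
  rw [EmbeddingScheme.eulerChar, numFaces_eq hn, card_vertex]
  rw [card_leviThree_edgeSet] at h ⊢
  push_cast
  omega

end Hypergraph

/-! ### From trail systems to quadrangular embeddings -/

section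

open Equiv Equiv.Perm

namespace Hypergraph

variable {n : ℕ}

/-- A numbering of the neighbours of an edge. -/
noncomputable def label (e : (completeThreeUniform n).edgeSet) :
    (leviThree n).neighborSet (.inr e) ≃ Fin 3 :=
  (Equiv.ofBijective (fun x : e.1 => (nbPt x.1 x.2 : (leviThree n).neighborSet (.inr e)))
    ⟨fun _ _ h => Subtype.ext (pt_injective (congrArg Subtype.val h)), by
      rintro ⟨⟨a, _⟩ | f, h⟩
      · exact ⟨⟨a, h⟩, rfl⟩
      · exact h.elim⟩).symm.trans
  (Finite.equivFinOfCardEq e.2)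

/-- The point of an edge with a given number. -/
noncomputable def point (e : (completeThreeUniform n).edgeSet) (i : Fin 3) : Fin n :=
  match (label e).symm i with
  | ⟨.inl a, _⟩ => a.1
  | ⟨.inr _, h⟩ => h.elim

theorem exists_eq_nbPt {e : (completeThreeUniform n).edgeSet}
    (x : (leviThree n).neighborSet (.inr e)) : ∃ a h, x = nbPt a h := by
  obtain ⟨⟨a, _⟩ | f, h⟩ := x
  · exact ⟨a, h, rfl⟩
  · exact h.elim

theorem point_label {e : (completeThreeUniform n).edgeSet} (a : Fin n) (h : a ∈ e.1) :
    point e (label e (nbPt a h)) = a := by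
  rw [point]
  simp [nbPt]

theorem exists_label (e : (completeThreeUniform n).edgeSet) (i : Fin 3) :
    ∃ h : point e i ∈ e.1, label e (nbPt (point e i) h) = i := by
  obtain ⟨a, h, hx⟩ := exists_eq_nbPt ((label e).symm i)
  have h1 : label e (nbPt a h) = i := by rw [← hx, apply_symm_apply]
  have h2 : point e i = a := by rw [← h1, point_label]
  subst h2
  exact ⟨h, h1⟩

theorem label_injective {e : (completeThreeUniform n).edgeSet} {a b : Fin n} {ha : a ∈ e.1}
    {hb : b ∈ e.1} (h : label e (nbPt a ha) = label e (nbPt b hb)) : a = b := by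
  rw [← point_label a ha, h, point_label]

/-- The sign of the cyclic order of an edge: positive if `b` follows `a`. -/
noncomputable def cyclicSign (e : (completeThreeUniform n).edgeSet) {a b : Fin n} (ha : a ∈ e.1)
    (hb : b ∈ e.1) : ℤˣ :=
  if label e (nbPt b hb) = label e (nbPt a ha) + 1 then 1 else -1

theorem cyclicSign_rotate {e : (completeThreeUniform n).edgeSet} {a b c : Fin n} (ha : a ∈ e.1)
    (hb : b ∈ e.1) (hc : c ∈ e.1) (hab : a ≠ b) (hac : a ≠ c) (hbc : b ≠ c) :
    cyclicSign e hb hc = cyclicSign e ha hb := by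
  have h1 := mt (label_injective (ha := ha) (hb := hb)) hab
  have h2 := mt (label_injective (ha := ha) (hb := hc)) hac
  have h3 := mt (label_injective (ha := hb) (hb := hc)) hbc
  unfold cyclicSign
  generalize label e (nbPt a ha) = i at *
  generalize label e (nbPt b hb) = j at *
  generalize label e (nbPt c hc) = k at *
  revert i j k
  decide

theorem addRight_zpow_cyclicSign {e : (completeThreeUniform n).edgeSet} {a b : Fin n} (ha : a ∈ e.1)
    (hb : b ∈ e.1) (hab : a ≠ b) :
    ((Equiv.addRight 1 : Perm (Fin 3)) ^ ((cyclicSign e ha hb : ℤˣ) : ℤ)) (label e (nbPt a ha)) =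
      label e (nbPt b hb) := by
  have h1 := mt (label_injective (ha := ha) (hb := hb)) hab
  unfold cyclicSign
  generalize label e (nbPt a ha) = i at *
  generalize label e (nbPt b hb) = j at *
  split_ifs with h
  · simp [h]
  · have : i = j + 1 := by revert i j; decide
    simp [this]

end Hypergraph

namespace TrailSystem

open Hypergraph

variable {n : ℕ} (S : TrailSystem (Fin n))

theorem turn_mem_iff (a : Fin n) (p : Fin n × Fin n) :
    ((turn (S.mate a) (S.mate_mate a) p).1 ≠ a ∧ (turn (S.mate a) (S.mate_mate a) p).2 ≠ a ∧
      (turn (S.mate a) (S.mate_mate a) p).1 ≠ (turn (S.mate a) (S.mate_mate a) p).2 ∧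
      S.sgn a (turn (S.mate a) (S.mate_mate a) p).1 (turn (S.mate a) (S.mate_mate a) p).2 = 1) ↔
    (p.1 ≠ a ∧ p.2 ≠ a ∧ p.1 ≠ p.2 ∧ S.sgn a p.1 p.2 = 1) := by
  obtain ⟨c, b⟩ := p
  rw [turn_apply]
  simp only
  constructor
  · rintro ⟨h1, h2, h3, h4⟩
    have h5 := S.mate_ne h1.symm h2 h3.symm
    have h6 := S.mate_ne_right h1.symm h2 h3.symm
    have h7 := S.sgn_mate h1.symm h2 h3.symm
    rw [S.mate_mate] at h5 h6 h7
    refine ⟨h5, h1, h6, ?_⟩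
    rw [S.sgn_swap h1 h5 h6.symm, h7, h4, neg_neg]
  · rintro ⟨h1, h2, h3, h4⟩
    refine ⟨h2, S.mate_ne h2.symm h1 h3, (S.mate_ne_right h2.symm h1 h3).symm, ?_⟩
    rw [S.sgn_mate h2.symm h1 h3, ← S.sgn_swap h2 h1 h3.symm, h4]

/-- The arcs of the trail of `a`. -/
abbrev Arc (a : Fin n) : Type :=
  {p : Fin n × Fin n // p.1 ≠ a ∧ p.2 ≠ a ∧ p.1 ≠ p.2 ∧ S.sgn a p.1 p.2 = 1}

/-- The trail of `a`. -/
def arcTurn (a : Fin n) : Perm (S.Arc a) :=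
  (turn (S.mate a) (S.mate_mate a)).subtypePerm (S.turn_mem_iff a)

theorem sameCycle_arcTurn (a : Fin n) (p q : S.Arc a) : (S.arcTurn a).SameCycle p q := by
  obtain ⟨⟨c, b⟩, h1, h2, h3, h4⟩ := p
  obtain ⟨⟨c', b'⟩, h5, h6, h7, h8⟩ := q
  exact sameCycle_subtypePerm.2 (S.sameCycle h1 h2 h3 h4 h5 h6 h7 h8)

/-- The arcs of the trail of `a` are the edges that contain `a`. -/
noncomputable def arcEquiv (a : (completeThreeUniform n).vertexSet) :
    S.Arc a.1 ≃ (leviThree n).neighborSet (.inl a) :=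
  Equiv.ofBijective (fun p => nbEdge (triple p.2.1.symm p.2.2.1.symm p.2.2.2.1) (by simp [triple]))
    ⟨by
      rintro ⟨⟨c, b⟩, h1, h2, h3, h4⟩ ⟨⟨c', b'⟩, h5, h6, h7, h8⟩ h
      simp only at h1 h2 h3 h4 h5 h6 h7 h8
      have h : ({a.1, c, b} : Set (Fin n)) = {a.1, c', b'} :=
        congrArg Subtype.val (Sum.inr_injective (congrArg Subtype.val h))
      have hc : c ∈ ({a.1, c', b'} : Set (Fin n)) := by rw [← h]; simp
      have hb : b ∈ ({a.1, c', b'} : Set (Fin n)) := by rw [← h]; simp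
      simp only [Set.mem_insert_iff, Set.mem_singleton_iff, h1, h2, false_or] at hc hb
      rcases hc with rfl | rfl <;> rcases hb with rfl | rfl
      · exact absurd rfl h3
      · rfl
      · rw [S.sgn_swap h1 h2 h3, h4] at h8
        exact absurd h8 (by decide)
      · exact absurd rfl h3, by
      rintro ⟨f | e, h⟩
      · exact h.elim
      · have h : a.1 ∈ e.1 := h
        obtain ⟨b, c, hab, hac, hbc, hb, hc⟩ := exists_of_mem h
        -- Exactly one of the two directions of the pair `b, c` belongs to the trail of `a`.
        rcases Int.units_eq_one_or (S.sgn a.1 b c) with hs | hs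
        · refine ⟨⟨(b, c), hab.symm, hac.symm, hbc, hs⟩, Subtype.ext (congrArg Sum.inr ?_)⟩
          exact Subtype.ext (eq_insert_of_mem hab hac hbc h hb hc).symm
        · have hs' : S.sgn a.1 c b = 1 := by rw [S.sgn_swap hab.symm hac.symm hbc, hs, neg_neg]
          refine ⟨⟨(c, b), hac.symm, hab.symm, hbc.symm, hs'⟩, Subtype.ext (congrArg Sum.inr ?_)⟩
          exact Subtype.ext (eq_insert_of_mem hac hab hbc.symm h hc hb).symm⟩

theorem arcEquiv_symm {a : (completeThreeUniform n).vertexSet} {b c : Fin n} (hb : b ≠ a.1)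
    (hc : c ≠ a.1) (hcb : c ≠ b) (hs : S.sgn a.1 c b = 1) {e : (completeThreeUniform n).edgeSet}
    (ha : a.1 ∈ e.1) (hbe : b ∈ e.1) (hce : c ∈ e.1) :
    (S.arcEquiv a).symm (nbEdge e ha) = ⟨(c, b), hc, hb, hcb, hs⟩ := by
  rw [Equiv.symm_apply_eq]
  exact Subtype.ext (congrArg Sum.inr
    (Subtype.ext (eq_insert_of_mem hc.symm hb.symm hcb ha hce hbe)))

/-- The sign of an edge of the Levi graph compares the directions of a trail and of a triple. -/
noncomputable def leviSign (a : Fin n) (e : (completeThreeUniform n).edgeSet) : ℤˣ :=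
  open Classical in
  if h : a ∈ e.1 then
    S.sgn a (point e (label e (nbPt a h) + 1)) (point e (label e (nbPt a h) + 2))
  else 1

/-- The numbering drops out: exchanging `b` and `c` changes both factors on the right. -/
theorem leviSign_eq {e : (completeThreeUniform n).edgeSet} {a b c : Fin n} (ha : a ∈ e.1)
    (hb : b ∈ e.1) (hc : c ∈ e.1) (hab : a ≠ b) (hac : a ≠ c) (hbc : b ≠ c) :
    S.leviSign a e = S.sgn a b c * cyclicSign e ha hb := by
  have h1 := mt (label_injective (ha := ha) (hb := hb)) hab
  have h2 := mt (label_injective (ha := ha) (hb := hc)) hac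
  have h3 := mt (label_injective (ha := hb) (hb := hc)) hbc
  have key : ∀ i j k : Fin 3, i ≠ j → i ≠ k → j ≠ k →
      (j = i + 1 ∧ k = i + 2) ∨ (j ≠ i + 1 ∧ j = i + 2 ∧ k = i + 1) := by decide
  rw [leviSign, dif_pos ha, cyclicSign]
  rcases key _ _ _ h1 h2 h3 with ⟨h4, h5⟩ | ⟨h4, h5, h6⟩
  · rw [if_pos h4, ← h4, ← h5, point_label, point_label, mul_one]
  · rw [if_neg h4, ← h5, ← h6, point_label, point_label, S.sgn_swap hab.symm hac.symm hbc]
    simp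

/-- The sign of an edge of the Levi graph in terms of its two ends. -/
noncomputable def endSign : ((completeThreeUniform n).vertexSet ⊕ (completeThreeUniform n).edgeSet) →
    ((completeThreeUniform n).vertexSet ⊕ (completeThreeUniform n).edgeSet) → ℤˣ
  | .inl a, .inr e => S.leviSign a.1 e
  | .inr e, .inl a => S.leviSign a.1 e
  | _, _ => 1

theorem endSign_comm (v w) : S.endSign v w = S.endSign w v := by
  rcases v with v | v <;> rcases w with w | w <;> rfl

/-- The rotations of the embedding scheme of a trail system. -/
noncomputable def rotation : ∀ v, Perm ((leviThree n).neighborSet v)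
  | .inl a => (S.arcEquiv a).permCongr (S.arcTurn a.1)
  | .inr e => (label e).symm.permCongr (Equiv.addRight 1)

/-- The embedding scheme of a trail system. -/
noncomputable def scheme : EmbeddingScheme (leviThree n) where
  rot := S.rotation
  rot_isCycleOn v := by
    refine ⟨Set.bijOn_univ.2 (Equiv.bijective _), fun x _ y _ => ?_⟩
    rcases v with a | e
    · exact sameCycle_permCongr _ (S.sameCycle_arcTurn a.1) x y
    · refine sameCycle_permCongr _ (fun i j => ?_) x y
      refine ⟨((j - i : Fin 3) : ℕ), ?_⟩
      revert i j; decide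
  sign x := Sym2.lift ⟨S.endSign, S.endSign_comm⟩ x.1

theorem dartSign_scheme (d : (leviThree n).Dart) : S.scheme.dartSign d = S.endSign d.fst d.snd := rfl

open EmbeddingScheme

theorem rotation_edge {e : (completeThreeUniform n).edgeSet} {a b : Fin n} (ha : a ∈ e.1)
    (hb : b ∈ e.1) (hab : a ≠ b) :
    (S.rotation (.inr e) ^ ((cyclicSign e ha hb : ℤˣ) : ℤ)) (nbPt a ha) = nbPt b hb := by
  apply (label e).injective
  rw [← addRight_zpow_cyclicSign ha hb hab]
  change label e (((label e).symm.permCongr (Equiv.addRight 1) ^ _) _) = _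
  have : ∀ k : ℤ, (label e).symm.permCongr (Equiv.addRight 1) ^ k =
      (label e).symm.permCongr ((Equiv.addRight 1) ^ k) := fun k =>
    (map_zpow (label e).symm.permCongrHom (Equiv.addRight 1) k).symm
  rw [this]
  simp

theorem rotation_point {a : (completeThreeUniform n).vertexSet} {b c d : Fin n} (hb : b ≠ a.1)
    (hc : c ≠ a.1) (hcb : c ≠ b) (hd : d = S.mate a.1 b c)
    {e f : (completeThreeUniform n).edgeSet}
    (ha : a.1 ∈ e.1) (hbe : b ∈ e.1) (hce : c ∈ e.1) (haf : a.1 ∈ f.1) (hbf : b ∈ f.1)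
    (hdf : d ∈ f.1) :
    (S.rotation (.inl a) ^ ((S.sgn a.1 c b : ℤˣ) : ℤ)) (nbEdge e ha) = nbEdge f haf := by
  have key : ∀ {c d : Fin n} {e f : (completeThreeUniform n).edgeSet} (ha : a.1 ∈ e.1)
      (haf : a.1 ∈ f.1), c ≠ a.1 → c ≠ b → d = S.mate a.1 b c → b ∈ e.1 → c ∈ e.1 →
      b ∈ f.1 → d ∈ f.1 → S.sgn a.1 c b = 1 →
      S.rotation (.inl a) (nbEdge e ha) = nbEdge f haf := by
    intro c d e f ha haf hc hcb hd hbe hce hbf hdf hs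
    subst hd
    have hs' : S.sgn a.1 b (S.mate a.1 b c) = 1 := by
      rw [S.sgn_mate hb.symm hc hcb, ← S.sgn_swap hb hc hcb.symm, hs]
    change S.arcEquiv a (S.arcTurn a.1 ((S.arcEquiv a).symm (nbEdge e ha))) = _
    rw [S.arcEquiv_symm hb hc hcb hs ha hbe hce, ← Equiv.eq_symm_apply,
      S.arcEquiv_symm (S.mate_ne hb.symm hc hcb) hb (S.mate_ne_right hb.symm hc hcb).symm hs' haf
        hdf hbf]
    rfl
  rcases Int.units_eq_one_or (S.sgn a.1 c b) with hs | hs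
  · rw [hs]
    simpa using key ha haf hc hcb hd hbe hce hbf hdf hs
  · rw [hs]
    have hda : d ≠ a.1 := by rw [hd]; exact S.mate_ne hb.symm hc hcb
    have hdb : d ≠ b := by rw [hd]; exact S.mate_ne_right hb.symm hc hcb
    have hs' : S.sgn a.1 d b = 1 := by
      rw [S.sgn_swap hb hda hdb.symm, hd, S.sgn_mate hb.symm hc hcb, neg_neg,
        S.sgn_swap hc hb hcb, hs, neg_neg]
    -- The inverse rotation reads the passage `c, b, d` backwards, so the forward case applies to
    -- `d, b, c`.
    have := key haf ha hda hdb (by rw [hd, S.mate_mate]) hbf hdf hbe hce hs'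
    rw [Units.val_neg, Units.val_one, zpow_neg_one, Perm.inv_eq_iff_eq, this]

theorem next_point {a b c : Fin n} {e : (completeThreeUniform n).edgeSet} (ha : a ∈ e.1)
    (hb : b ∈ e.1) (hc : c ∈ e.1) (hab : a ≠ b) (hac : a ≠ c) (hbc : b ≠ c) {k : ℤˣ}
    (hk : k = S.sgn a b c) :
    S.scheme.next (dartTo (pt a) (nbEdge e ha), k) =
      (dartTo (.inr e) (nbPt b hb), cyclicSign e ha hb) := by
  have hm : k * S.scheme.dartSign (dartTo (pt a) (nbEdge e ha)) = cyclicSign e ha hb := by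
    rw [dartSign_scheme]
    change k * S.leviSign a e = _
    rw [S.leviSign_eq ha hb hc hab hac hbc, hk, ← mul_assoc, Int.units_mul_self, one_mul]
  rw [next, hm]
  refine Prod.ext ?_ rfl
  exact congrArg (dartTo (G := leviThree n) (Sum.inr e)) (S.rotation_edge ha hb hab)

theorem next_edge {a b c d : Fin n} {e f : (completeThreeUniform n).edgeSet} (ha : a ∈ e.1)
    (hb : b ∈ e.1) (hc : c ∈ e.1) (hab : a ≠ b) (hac : a ≠ c) (hbc : b ≠ c)
    (hd : d = S.mate a b c) (haf : a ∈ f.1) (hbf : b ∈ f.1) (hdf : d ∈ f.1) :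
    S.scheme.next (dartTo (.inr e) (nbPt b hb), cyclicSign e ha hb) =
      (dartTo (pt b) (nbEdge f hbf), S.sgn b c a) := by
  have hm : cyclicSign e ha hb * S.scheme.dartSign (dartTo (.inr e) (nbPt b hb)) = S.sgn b c a := by
    rw [dartSign_scheme]
    change _ * S.leviSign b e = _
    rw [S.leviSign_eq hb hc ha hbc hab.symm hac.symm, cyclicSign_rotate ha hb hc hab hac hbc,
      mul_left_comm, Int.units_mul_self, mul_one]
  rw [next, hm]
  refine Prod.ext ?_ rfl
  exact congrArg (dartTo (G := leviThree n) (pt b)) (S.rotation_point (a := ⟨b, Set.mem_univ b⟩) hab hbc.symm hac.symm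
    (by rw [hd, S.mate_comm]) hb ha hc hbf haf hdf)

/-- Half of a quadrangle: the face passes from `a` through the triple `abc` to `b` and continues
into the triple `abd`, where `d` is the mate of `c`. The signatures are designed so that the mode at
a point is the direction of its trail. -/
theorem next_next_point {a b c : Fin n} {e f : (completeThreeUniform n).edgeSet} (ha : a ∈ e.1)
    (hb : b ∈ e.1) (hc : c ∈ e.1) (hab : a ≠ b) (hac : a ≠ c) (hbc : b ≠ c) {k : ℤˣ}
    (hk : k = S.sgn a b c) (haf : a ∈ f.1) (hbf : b ∈ f.1) (hdf : S.mate a b c ∈ f.1) :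
    S.scheme.next (S.scheme.next (dartTo (pt a) (nbEdge e ha), k)) =
      (dartTo (pt b) (nbEdge f hbf), S.sgn b c a) := by
  rw [S.next_point ha hb hc hab hac hbc hk, S.next_edge ha hb hc hab hac hbc rfl haf hbf hdf]

/-- The second half starts at `b` in the triple `abd` and returns to `a` and to `abc`, because the
transitions are symmetric in `a, b` and involutive. -/
theorem next_four_point {a : Fin n} {e : (completeThreeUniform n).edgeSet} (ha : a ∈ e.1) (k : ℤˣ) :
    S.scheme.next (S.scheme.next (S.scheme.next (S.scheme.next (dartTo (pt a) (nbEdge e ha), k)))) =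
      (dartTo (pt a) (nbEdge e ha), k) := by
  obtain ⟨b, c, hab, hac, hbc, hb, hc, hk⟩ : ∃ b c, a ≠ b ∧ a ≠ c ∧ b ≠ c ∧ b ∈ e.1 ∧ c ∈ e.1 ∧
      k = S.sgn a b c := by
    obtain ⟨b, c, hab, hac, hbc, hb, hc⟩ := exists_of_mem ha
    -- The mode decides which of the two other points of the triple the face visits next.
    by_cases hk : k = S.sgn a b c
    · exact ⟨b, c, hab, hac, hbc, hb, hc, hk⟩
    · refine ⟨c, b, hac, hab, hbc.symm, hc, hb, ?_⟩
      rw [S.sgn_swap hab.symm hac.symm hbc]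
      exact Int.units_ne_iff_eq_neg.1 hk
  have h1 := S.mate_ne hab hac.symm hbc.symm
  have h2 := S.mate_ne_right hab hac.symm hbc.symm
  let f := triple hab h1.symm h2.symm
  have haf : a ∈ f.1 := by simp [f, triple]
  have hbf : b ∈ f.1 := by simp [f, triple]
  have hdf : S.mate a b c ∈ f.1 := by simp [f, triple]
  rw [S.next_next_point ha hb hc hab hac hbc hk haf hbf hdf,
    S.next_next_point (f := e) hbf haf hdf hab.symm h2.symm h1.symm ?_ hb ha ?_]
  · rw [S.sgn_swap hab.symm h1 h2.symm, S.sgn_mate hab hac.symm hbc.symm, neg_neg, hk]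
  · rw [S.mate_comm a b, S.sgn_mate hab.symm hbc.symm hac.symm, S.sgn_swap hab hbc.symm hac]
  · rw [S.mate_comm b a, S.mate_mate]; exact hc

theorem next_four (x : Flag (leviThree n)) :
    S.scheme.next (S.scheme.next (S.scheme.next (S.scheme.next x))) = x := by
  have key : ∀ x : Flag (leviThree n), x.1.fst.isLeft →
      S.scheme.next (S.scheme.next (S.scheme.next (S.scheme.next x))) = x := by
    rintro ⟨⟨⟨⟨a, ha⟩ | e, ⟨b, hb⟩ | f⟩, h⟩, k⟩ hx
    · exact h.elim
    · exact S.next_four_point (a := a) (e := f) h k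
    · simp at hx
    · simp at hx
  by_cases hx : x.1.fst.isLeft
  · exact key x hx
  -- A flag leaving a triple is moved one step on, to a flag leaving a point.
  · apply S.scheme.next_injective
    apply key
    rw [fst_next]
    obtain ⟨⟨⟨⟨a, ha⟩ | e, ⟨b, hb⟩ | f⟩, h⟩, k⟩ := x
    · simp at hx
    · simp at hx
    · simp
    · exact h.elim

theorem isOrientable_of_scheme (h : S.scheme.IsOrientable) : S.IsOrientable := by
  obtain ⟨s, hs⟩ := h
  refine ⟨fun a => s (pt a), fun a b c hab hbc hac => ?_⟩
  let e := triple hab hac hbc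
  have ha : a ∈ e.1 := by simp [e, triple]
  have hb : b ∈ e.1 := by simp [e, triple]
  have hc : c ∈ e.1 := by simp [e, triple]
  have h1 : S.leviSign a e = s (pt a) * s (.inr e) := hs (dartTo (pt a) (nbEdge e ha))
  have h2 : S.leviSign b e = s (pt b) * s (.inr e) := hs (dartTo (pt b) (nbEdge e hb))
  rw [S.leviSign_eq ha hb hc hab hac hbc] at h1
  rw [S.leviSign_eq hb hc ha hbc hab.symm hac.symm, cyclicSign_rotate ha hb hc hab hac hbc] at h2
  have h3 : ∀ x y z w : ℤˣ, x * y = z * w → z * x = y * w := by decide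
  rw [h3 _ _ _ _ h1, h3 _ _ _ _ h2]

theorem IsOrientable.scheme {S : TrailSystem (Fin n)} (h : S.IsOrientable) :
    S.scheme.IsOrientable := by
  obtain ⟨t, ht⟩ := h
  -- The switching at a triple is read off at its first point; orientability makes the choice of
  -- this point irrelevant.
  let u (e : (completeThreeUniform n).edgeSet) : ℤˣ :=
    t (point e 0) * S.sgn (point e 0) (point e 1) (point e 2)
  have key : ∀ (a : Fin n) (e : (completeThreeUniform n).edgeSet), a ∈ e.1 →
      S.leviSign a e = t a * u e := by
    intro a e ha
    have hne : ∀ i j : Fin 3, i ≠ j → point e i ≠ point e j := by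
      intro i j hij hp
      obtain ⟨h1, h2⟩ := exists_label e i
      obtain ⟨h3, h4⟩ := exists_label e j
      apply hij
      rw [← h2, ← h4]
      congr 1
      exact Subtype.ext (congrArg pt hp)
    have h1 := ht _ _ _ (hne 0 1 (by decide)) (hne 1 2 (by decide)) (hne 0 2 (by decide))
    have h2 := ht _ _ _ (hne 1 2 (by decide)) (hne 2 0 (by decide)) (hne 1 0 (by decide))
    have h3 : ∀ x y z : ℤˣ, x * y = z → y = x * z := by decide
    rw [leviSign, dif_pos ha]
    have h4 := point_label a ha
    generalize label e (nbPt a ha) = i at *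
    subst h4
    apply h3
    simp only [u]
    fin_cases i
    · rfl
    · exact h1.symm
    · exact (h1.trans h2).symm
  refine ⟨Sum.elim (fun a => t a.1) u, ?_⟩
  rintro ⟨⟨⟨a, ha⟩ | e, ⟨b, hb⟩ | f⟩, h⟩
  · exact h.elim
  · exact key a f h
  · exact (key b e h).trans (mul_comm _ _)
  · exact h.elim

end TrailSystem

end

/-! ### The genus formulas -/

namespace Hypergraph

/-- The genus of the complete 3-uniform hypergraph on `2k + 4` points. -/
theorem exists_genus {n : ℕ} (hn : 4 ≤ n) (he : Even n) :
    ∃ g : ℕ, (n.choose 3 : ℤ) = 2 * n - 4 + 4 * g ∧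
      24 * (g : ℤ) = ((n : ℤ) - 2) * (n + 3) * (n - 4) := by
  obtain ⟨k, rfl⟩ : ∃ k, n = 2 * k + 4 := by
    obtain ⟨m, rfl⟩ := he
    exact ⟨m - 2, by omega⟩
  -- The genus formula at `n = 2 * k + 4`; its increment in `k` is `(k + 1) * (k + 3)`.
  obtain ⟨g, hg⟩ : ∃ g : ℕ, 6 * g = k * (k + 1) * (2 * k + 7) := by
    clear hn he
    induction k with
    | zero => exact ⟨0, by simp⟩
    | succ k ih =>
      obtain ⟨g, hg⟩ := ih
      exact ⟨g + (k + 1) * (k + 3), by rw [mul_add, hg]; ring⟩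
  have hc : 6 * (2 * k + 4).choose 3 = (2 * k + 4) * (2 * k + 3) * (2 * k + 2) := by
    have := Nat.descFactorial_eq_factorial_mul_choose (2 * k + 4) 3
    simp only [Nat.descFactorial_succ, Nat.descFactorial_zero] at this
    rw [show (6 : ℕ) = Nat.factorial 3 from rfl, ← this]
    simp only [show 2 * k + 4 - 2 = 2 * k + 2 by omega, show 2 * k + 4 - 1 = 2 * k + 3 by omega]
    rw [Nat.sub_zero]
    ring
  zify at hg hc
  refine ⟨g, ?_, ?_⟩
  · push_cast
    linarith
  · push_cast
    linarith

theorem orientableGenus_completeThreeUniform {n g : ℕ} (hn : 4 ≤ n) (he : Even n)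
    (hg : (n.choose 3 : ℤ) = 2 * n - 4 + 4 * g) :
    (completeThreeUniform n).orientableGenus = (g : ℕ∞) := by
  obtain ⟨S, hS⟩ := exists_trailSystem_isOriented hn he
  rw [orientableGenus, SimpleGraph.orientableGenus]
  refine le_antisymm ?_ (le_iInf fun h => le_iInf ?_)
  · refine iInf₂_le g ⟨leviThree_connected hn, S.scheme, hS.isOrientable.scheme, ?_⟩
    have := two_mul_eulerChar_eq hn S.scheme S.next_four
    suffices h : S.scheme.eulerChar = 2 - 2 * (g : ℤ) from h
    omega
  · rintro ⟨-, T, -, hT⟩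
    have := two_mul_eulerChar_le hn T
    exact Nat.cast_le.2 (by omega)

theorem nonorientableGenus_completeThreeUniform {n g : ℕ} (hn : 6 ≤ n) (he : Even n)
    (hg : (n.choose 3 : ℤ) = 2 * n - 4 + 4 * g) (hpos : 0 < g) :
    (completeThreeUniform n).nonorientableGenus = ((2 * g : ℕ) : ℕ∞) := by
  have hn' : 4 ≤ n := by omega
  obtain ⟨S, hS⟩ := exists_trailSystem_not_isOrientable hn he
  -- The Euler bound is `2 - 2 * g`, which is less than `2` since `g` is positive.
  have hplanar : ¬ (completeThreeUniform n).leviGraph.CellEmbedsOrientable 0 := by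
    rintro ⟨-, T, -, hT⟩
    have := two_mul_eulerChar_le hn' T
    omega
  rw [nonorientableGenus, SimpleGraph.nonorientableGenus, if_neg hplanar]
  refine le_antisymm ?_ (le_iInf fun h => le_iInf ?_)
  · refine iInf₂_le (2 * g) ⟨leviThree_connected hn', S.scheme,
      fun h => hS (S.isOrientable_of_scheme h), ?_⟩
    have := two_mul_eulerChar_eq hn' S.scheme S.next_four
    suffices h : S.scheme.eulerChar = 2 - ((2 * g : ℕ) : ℤ) from h
    push_cast
    omega
  · rintro ⟨-, T, -, hT⟩
    have := two_mul_eulerChar_le hn' T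
    exact Nat.cast_le.2 (by omega)

end Hypergraph

theorem theorem1p2 :
    (∀ n : ℕ, 4 ≤ n → Even n →
      ∃ g : ℕ, (Hypergraph.completeThreeUniform n).orientableGenus = (g : ℕ∞) ∧
        (g : ℚ) = ((n : ℚ) - 2) * ((n : ℚ) + 3) * ((n : ℚ) - 4) / 24) ∧
    (∀ n : ℕ, 6 ≤ n → Even n →
      ∃ g : ℕ, (Hypergraph.completeThreeUniform n).nonorientableGenus = (g : ℕ∞) ∧
        (g : ℚ) = ((n : ℚ) - 2) * ((n : ℚ) + 3) * ((n : ℚ) - 4) / 12) := by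
  constructor
  · intro n hn he
    obtain ⟨g, h1, h2⟩ := Hypergraph.exists_genus hn he
    refine ⟨g, Hypergraph.orientableGenus_completeThreeUniform hn he h1, ?_⟩
    qify at h2
    linarith
  · intro n hn he
    obtain ⟨g, h1, h2⟩ := Hypergraph.exists_genus (by omega) he
    have hpos : 0 < g := by
      have h3 : (0 : ℤ) < 24 * (g : ℤ) := by
        have hn' : (6 : ℤ) ≤ n := by exact_mod_cast hn
        rw [h2]
        exact mul_pos (mul_pos (by linarith) (by linarith)) (by linarith)
      omega
    refine ⟨2 * g, Hypergraph.nonorientableGenus_completeThreeUniform hn he h1 hpos, ?_⟩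
    qify at h2
    push_cast
    linarith
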